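/- For $y\in(-1,1)$ let $$G(x,y)=\frac1\pi\,\operatorname{argsinh}\sqrt{\frac{(1-x^2)(1-y^2)}{(x-y)^2}}\quad\text{if }x\in(-1,1),\qquad G(x,y)=0\quad\text{if }x\notin(-1,1),$$ be the Riesz Green function of $(-\Delta)^{1/2}$ on $(-1,1)$, and let $$g(x,z)=\tfrac12\big[(z-x)\,G(x,z)+(z+x)\,G(x,-z)\big],\qquad x\in\mathbb R,\ z\in(-1,1),$$ where $(z-x)G(x,z)$ is read as $0$ at $x=z$ and $(z+x)G(x,-z)$ is read as $0$ at $x=-z$. For an integrable function $u:\mathbb R\to\mathbb R$ let $I(u)=-(-\Delta)^{1/2}u$, that is, $I(u)$ is the tempered distribution with Fourier transform $-|k|\,\hat u(k)$, where $\hat u(k)=\int_{\mathbb R}u(x)e^{-ixk}\,dx$. **Proposition.** For every $z\in(-1,1)$, the function $x\mapsto g(x,z)$ is continuous on $\mathbb R$ and it is the unique integrable function $u:\mathbb R\to\mathbb R$ such that $$\begin{cases} I(u)'=\tfrac12\,[\delta_z-\delta_{-z}] & \text{in }\mathcal D'(-1,1),\\ u(x)=0 & \text{for } x\in\mathbb R\setminus(-1,1),\\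 u(x)=o\big((1-x^2)^{1/2}\big) & \text{as }x\to\pm1,\ x\in(-1,1).\end{cases}$$ More precisely, $g(\cdot,z)$ is a solution; every integrable solution $u$ is equal to $g(\cdot,z)$ almost everywhere; and every integrable solution that is continuous on $(-1,1)$ is equal to $g(\cdot,z)$ everywhere on $\mathbb R$. -/

import Mathlib

open MeasureTheory Set Filter Topology Asymptotics TopologicalSpace
open scoped SchwartzMap FourierTransform Distributions LineDeriv ContDiff

noncomputable section

namespace HydraulicFracture

/-- The open interval `(-1, 1)`, as an open subset of `ℝ`. -/
def symmInterval : Opens ℝ := ⟨Ioo (-1) 1, isOpen_Ioo⟩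

/-! ### Restriction of a tempered distribution on `ℝ` to an open set -/

/-- A real test function on `Ω`, regarded as a complex-valued Schwartz function on `ℝ`. -/
def testToSchwartz {Ω : Opens ℝ} (φ : 𝓓(Ω, ℝ)) : 𝓢(ℝ, ℂ) :=
  HasCompactSupport.toSchwartzMap (f := fun x => ((φ x : ℝ) : ℂ))
    (φ.hasCompactSupport.comp_left (g := ((↑) : ℝ → ℂ)) Complex.ofReal_zero)
    (Complex.ofRealCLM.contDiff.comp φ.contDiff)

theorem testToSchwartz_apply {Ω : Opens ℝ} (φ : 𝓓(Ω, ℝ)) (x : ℝ) :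
    testToSchwartz φ x = (φ x : ℂ) := rfl

/-- The inclusion of the test functions on `Ω` into the Schwartz space is continuous. -/
def testToSchwartzCLM (Ω : Opens ℝ) : 𝓓(Ω, ℝ) →L[ℝ] 𝓢(ℝ, ℂ) :=
  TestFunction.mkCLM ℝ testToSchwartz
    (fun f g => by ext x; simp [testToSchwartz_apply])
    (fun c f => by ext x; simp [testToSchwartz_apply])
    (by
      intro K hK
      let Φ : 𝓓_{K}(ℝ, ℝ) →ₗ[ℝ] 𝓢(ℝ, ℂ) :=
        { toFun := fun f => testToSchwartz (TestFunction.ofSupportedIn hK f)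
          map_add' := fun f g => by ext x; simp [testToSchwartz_apply]
          map_smul' := fun c f => by ext x; simp [testToSchwartz_apply] }
      change Continuous Φ
      obtain ⟨R, hR⟩ := K.isCompact.isBounded.exists_norm_le
      refine WithSeminorms.continuous_of_isBounded
        (ContDiffMapSupportedIn.withSeminorms ℝ ℝ ℝ ⊤ K)
        (schwartz_withSeminorms ℝ ℝ ℂ) Φ (.of_real fun p => ?_)
      refine ⟨{p.2}, |R| ^ p.1, fun f => ?_⟩
      refine SchwartzMap.seminorm_le_bound ℝ p.1 p.2 (Φ f)
        (mul_nonneg (by positivity) (apply_nonneg _ _)) fun x => ?_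
      have h1 : ‖iteratedFDeriv ℝ p.2 (Φ f) x‖ = ‖iteratedFDeriv ℝ p.2 f x‖ :=
        Complex.ofRealLI.norm_iteratedFDeriv_comp_left (f := f)
          (f.contDiff.contDiffAt (x := x)) (mod_cast le_top)
      rw [h1]
      by_cases hx : x ∈ K
      · rw [Finset.sup_singleton]
        have := hR x hx
        gcongr
        · exact this.trans (le_abs_self R)
        · exact ContDiffMapSupportedIn.norm_iteratedFDeriv_apply_le_seminorm_top ℝ
      · rw [f.iteratedFDeriv_zero_on_compl hx]
        simp only [Pi.zero_apply, norm_zero, mul_zero]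
        exact mul_nonneg (by positivity) (apply_nonneg _ _))

/-- The restriction of a tempered distribution on `ℝ` to a distribution on the open set `Ω`. -/
def restrictDistribution (Ω : Opens ℝ) (T : 𝓢'(ℝ, ℂ)) : 𝓓'(Ω, ℂ) where
  toFun φ := T (testToSchwartzCLM Ω φ)
  map_add' φ ψ := by simp
  map_smul' c φ := by
    have h : testToSchwartzCLM Ω (c • φ) = (c : ℂ) • testToSchwartzCLM Ω φ := by
      rw [map_smul]
      ext x
      rfl
    rw [h]
    exact map_smul T (c : ℂ) _
  cont := (map_continuous T).comp (testToSchwartzCLM Ω).continuous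

/-! ### The operator `I = -(-Δ)^{1/2}` -/

/-- The Fourier transform of `I(u)`. With the convention `∫ f(x) e^{-ixk} dx` for the Fourier
transform, `(-Δ)^{1/2}` is the multiplier `|k|`; Mathlib's convention is `∫ f(x) e^{-2πixξ} dx`,
so that `k = 2πξ`. -/
def symbolI (u : ℝ → ℝ) (ξ : ℝ) : ℂ :=
  -((|2 * Real.pi * ξ| : ℝ) : ℂ) * 𝓕 (fun x : ℝ => (u x : ℂ)) ξ

theorem norm_symbolI_le (u : ℝ → ℝ) (ξ : ℝ) :
    ‖symbolI u ξ‖ ≤ (2 * Real.pi * ∫ x, ‖u x‖) * ‖ξ‖ := by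
  have h : ‖𝓕 (fun x : ℝ => (u x : ℂ)) ξ‖ ≤ ∫ x, ‖u x‖ := by
    have := VectorFourier.norm_fourierIntegral_le_integral_norm Real.fourierChar volume
      (innerₗ ℝ) (fun x : ℝ => (u x : ℂ)) ξ
    exact this.trans_eq (by simp)
  have h2 : ‖symbolI u ξ‖ = 2 * Real.pi * ‖ξ‖ * ‖𝓕 (fun x : ℝ => (u x : ℂ)) ξ‖ := by
    simp [symbolI, abs_mul, abs_of_pos Real.pi_pos]
  rw [h2, mul_right_comm]
  have := Real.pi_pos
  gcongr

theorem aestronglyMeasurable_symbolI (u : ℝ → ℝ) :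
    AEStronglyMeasurable (symbolI u) volume := by
  have hF : AEStronglyMeasurable (𝓕 (fun x : ℝ => (u x : ℂ))) volume := by
    by_cases hu : Integrable (fun x : ℝ => (u x : ℂ))
    · exact (VectorFourier.fourierIntegral_continuous Real.continuous_fourierChar
        (by fun_prop) hu).aestronglyMeasurable
    · have : 𝓕 (fun x : ℝ => (u x : ℂ)) = fun _ => 0 := by
        funext ξ
        rw [Real.fourier_eq]
        exact integral_undef fun h => hu ((Real.fourierIntegral_convergent_iff ξ).1 h)
      rw [this]
      exact aestronglyMeasurable_const
  refine AEStronglyMeasurable.mul ?_ hF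
  exact Continuous.aestronglyMeasurable (by fun_prop)

theorem integrable_smul_symbolI (u : ℝ → ℝ) (ψ : 𝓢(ℝ, ℂ)) :
    Integrable fun ξ => ψ ξ • symbolI u ξ := by
  refine ((ψ.integrable_pow_mul volume 1).const_mul (2 * Real.pi * ∫ x, ‖u x‖)).mono'
    (ψ.continuous.aestronglyMeasurable.smul (aestronglyMeasurable_symbolI u)) ?_
  refine .of_forall fun ξ => ?_
  rw [norm_smul, pow_one]
  calc ‖ψ ξ‖ * ‖symbolI u ξ‖ ≤ ‖ψ ξ‖ * ((2 * Real.pi * ∫ x, ‖u x‖) * ‖ξ‖) := by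
        gcongr; exact norm_symbolI_le u ξ
    _ = _ := by ring

/-- The function `symbolI u`, of at most linear growth, as a tempered distribution. -/
def symbolIDistribution (u : ℝ → ℝ) : 𝓢'(ℝ, ℂ) :=
  ContinuousLinearMap.toPointwiseConvergenceCLM ℂ (RingHom.id ℂ) 𝓢(ℝ, ℂ) ℂ <|
    SchwartzMap.mkCLMtoNormedSpace (𝕜 := ℂ) (fun ψ => ∫ ξ, ψ ξ • symbolI u ξ)
      (fun f g => by
        simp only [_root_.add_apply, add_smul]
        exact integral_add (integrable_smul_symbolI u f) (integrable_smul_symbolI u g))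
      (fun a f => by
        simp only [_root_.smul_apply, smul_assoc, RingHom.id_apply]
        exact integral_smul _ _)
      (by
        have hpi := Real.pi_pos
        have hI : 0 ≤ ∫ x, ‖u x‖ := integral_nonneg fun _ => norm_nonneg _
        let n := (volume : Measure ℝ).integrablePower
        let A : ℝ := 2 ^ n * ∫ x : ℝ, (1 + ‖x‖) ^ (-(n : ℝ))
        have hA : 0 ≤ A := mul_nonneg (by positivity) (integral_nonneg fun x => by positivity)
        refine ⟨{(0, 0), (1 + n, 0)}, (2 * Real.pi * ∫ x, ‖u x‖) * (A * 2), by positivity,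
          fun f => ?_⟩
        set s := (({(0, 0), (1 + n, 0)} : Finset (ℕ × ℕ)).sup
          (schwartzSeminormFamily ℂ ℝ ℂ)) f with hs
        have h0 : SchwartzMap.seminorm ℂ 0 0 f ≤ s :=
          Seminorm.le_finset_sup_apply (p := schwartzSeminormFamily ℂ ℝ ℂ) (i := (0, 0))
            (by simp)
        have h1 : SchwartzMap.seminorm ℂ (1 + n) 0 f ≤ s :=
          Seminorm.le_finset_sup_apply (p := schwartzSeminormFamily ℂ ℝ ℂ) (i := (1 + n, 0))
            (by simp)
        have hf := SchwartzMap.integral_pow_mul_iteratedFDeriv_le ℂ volume f 1 0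
        simp only [norm_iteratedFDeriv_zero] at hf
        calc ‖∫ ξ, f ξ • symbolI u ξ‖
            ≤ ∫ ξ, (2 * Real.pi * ∫ x, ‖u x‖) * (‖ξ‖ ^ 1 * ‖f ξ‖) := by
              refine norm_integral_le_of_norm_le
                ((f.integrable_pow_mul volume 1).const_mul _) (.of_forall fun ξ => ?_)
              rw [norm_smul, pow_one]
              calc ‖f ξ‖ * ‖symbolI u ξ‖
                  ≤ ‖f ξ‖ * ((2 * Real.pi * ∫ x, ‖u x‖) * ‖ξ‖) := by
                    gcongr; exact norm_symbolI_le u ξ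
                _ = _ := by ring
          _ = (2 * Real.pi * ∫ x, ‖u x‖) * ∫ ξ, ‖ξ‖ ^ 1 * ‖f ξ‖ := integral_const_mul _ _
          _ ≤ (2 * Real.pi * ∫ x, ‖u x‖) * (A * (s + s)) := by
              gcongr
              exact hf.trans (mul_le_mul_of_nonneg_left (add_le_add h0 h1) hA)
          _ = _ := by ring)

/-- `I(u) = -(-Δ)^{1/2} u`, as a tempered distribution on `ℝ`, for an integrable function `u`:
the inverse Fourier transform of `-|k| · û(k)`. -/
def opI (u : ℝ → ℝ) : 𝓢'(ℝ, ℂ) := 𝓕⁻ (symbolIDistribution u)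

theorem opI_apply (u : ℝ → ℝ) (ψ : 𝓢(ℝ, ℂ)) :
    opI u ψ = ∫ ξ, (𝓕⁻ ψ : 𝓢(ℝ, ℂ)) ξ • symbolI u ξ := rfl

/-! ### The Green functions and the boundary value problem -/

/-- The Green function of `(-Δ)^{1/2}` on `(-1, 1)`, in closed form. -/
def rieszG (x y : ℝ) : ℝ :=
  open Classical in
  if x ∈ Ioo (-1 : ℝ) 1 ∧ y ∈ Ioo (-1 : ℝ) 1 then
    Real.pi⁻¹ * Real.arsinh (√((1 - x ^ 2) * (1 - y ^ 2) / (x - y) ^ 2))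
  else 0

/-- `g(x, z) = ½ [(z - x) G(x, z) + (z + x) G(x, -z)]`. At `x = ±z` the infinite value of `G` is
multiplied by zero, and the product is read as zero (its limit). -/
def greenG (x z : ℝ) : ℝ :=
  1 / 2 * ((z - x) * rieszG x z + (z + x) * rieszG x (-z))

/-- `u` solves `I(u)' = ½ (δ_z - δ_{-z})` in `𝓓'(-1, 1)`, vanishes outside `(-1, 1)`, and is
`o((1 - x²)^{1/2})` as `x → ±1` (from inside). -/
structure IsGreenSolution (z : ℝ) (u : ℝ → ℝ) : Prop where
  integrable : Integrable u
  equation : ∂_{(1 : ℝ)} (restrictDistribution symmInterval (opI u)) =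
    Distribution.mapCLM Complex.ofRealCLM
      ((1 / 2 : ℝ) • (Distribution.delta z - Distribution.delta (-z) : 𝓓'(symmInterval, ℝ)))
  eq_zero : ∀ x ∉ Ioo (-1 : ℝ) 1, u x = 0
  isLittleO_left : u =o[𝓝[>] (-1)] fun x => √(1 - x ^ 2)
  isLittleO_right : u =o[𝓝[<] 1] fun x => √(1 - x ^ 2)

end HydraulicFracture

end

/-!
The Fourier multiplier `|k|` acts on test functions as `φ ↦ (1/π) log|·| * φ''`
(`fourier_abs_mul_fourierInv`): this is checked for the multiplier damped by `e^{-t|k|}`, whose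
Fourier transform is an explicit rational function, followed by `t → 0`. Hence, for an integrable
`u`, the equation `I(u)' = ½ (δ_z - δ_{-z})` on `(-1, 1)` says that the logarithmic potential
`L_u(y) = ∫ u(x) log |x - y| dx` has third derivative `-(π/2) (δ_z - δ_{-z})` there
(`equation_iff`).

The logarithmic kernel is diagonalised by the Chebyshev polynomials: if `μ` is the arcsine measure
`dy / √(1 - y²)` on `[-1, 1]`, then `∫ log |x - y| T_n(y) dμ(y) = -(π/n) T_n(x)`
(`integral_log_sub_mul_T`). In the variable `t = arccos y` this is the Fourier expansion of
`log |sin (t/2)|`. By Fubini, `∫ L_u T_n dμ = -(π/n) ∫ u T_n dx`. A density on `[-1, 1]` whose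
moments against `T_n` vanish for `n ≥ 3` is a quadratic polynomial times the arcsine density
(`exists_quadratic_of_moments_eq_zero`), by the orthogonality of the `T_n` and Weierstrass
approximation. Both halves of the result follow from this.

* Existence. Write `g(·, z) = ½ (k_z - k_{-z})` with `k_a(x) = (a - x) G(x, a)`. Since
  `G(cos t, cos φ) = (1/π) log |sin ((t+φ)/2) / sin ((t-φ)/2)|`, the moments of `k_a` are explicit,
  and for `n ≥ 3` those of its potential equal those of `-π (y - a)₊² / 2`. The two functions thus
  differ by a quadratic polynomial, so the third derivative of the potential is `-π δ_a`
  (`integral_fundSol_mul_integral_log`). At `x → ±1`, `k_a(x) / √(1 - x²)` has a limit that is even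
  in `a`, and the two limits cancel in `g`.
* Uniqueness. For the difference `d` of two solutions, du Bois-Reymond's lemma makes `L_d` a
  quadratic polynomial on `(-1, 1)`, so the moments of `d` of order at least `3` vanish, and `d` is
  a quadratic polynomial `P` divided by `√(1 - x²)`. The boundary condition reads `P = o(1 - x²)` at
  `±1`, which forces `P = 0` (`ae_eq_zero_of_homogeneous`).
-/

noncomputable section

namespace HydraulicFracture

/-! ### Fourier coefficients of `log |sin (t / 2)|` -/
open Real in
/-- The recursion for the cosine coefficients of `log (sin t)`, by integrating by parts against
`sin (2 (n + 1) t) - sin (2 n t)`, which vanishes with `sin t`. -/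
theorem two_mul_integral_log_sin_mul_cos_succ (n : ℕ) :
    2 * (n + 1) * ∫ t in (0 : ℝ)..π, log (sin t) * cos (2 * (n + 1) * t) =
      2 * n * (∫ t in (0 : ℝ)..π, log (sin t) * cos (2 * n * t)) - if n = 0 then π else 0 := by
  have hlog : IntervalIntegrable (fun t => log (sin t)) volume 0 π := intervalIntegrable_log_sin
  have hi : ∀ c : ℝ, IntervalIntegrable (fun t => log (sin t) * cos (c * t)) volume 0 π := fun c =>
    hlog.mul_continuousOn (by fun_prop)
  -- `sin (2 (n + 1) t) - sin (2 n t) = 2 sin t cos ((2 n + 1) t)`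
  have hF : ContinuousOn (fun t => sin t * log (sin t) * (2 * cos ((2 * n + 1) * t))) (Icc 0 π) :=
    ((continuous_mul_log.comp continuous_sin).mul (by fun_prop)).continuousOn
  have hd : ∀ t ∈ Ioo (0 : ℝ) π,
      HasDerivAt (fun t => sin t * log (sin t) * (2 * cos ((2 * n + 1) * t)))
        ((2 * (n + 1) * (log (sin t) * cos (2 * (n + 1) * t))
          - 2 * n * (log (sin t) * cos (2 * n * t)))
          + (cos (2 * (n + 1) * t) + cos (2 * n * t))) t := by
    intro t ht
    have hs : sin t ≠ 0 := (sin_pos_of_mem_Ioo ht).ne'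
    have h1 := ((hasDerivAt_sin t).mul ((hasDerivAt_sin t).log hs)).mul
      ((((hasDerivAt_id t).const_mul (2 * n + 1 : ℝ)).cos).const_mul 2)
    refine h1.congr_deriv ?_
    have e1 : 2 * ((n : ℝ) + 1) * t = (2 * n + 1) * t + t := by ring
    have e2 : 2 * (n : ℝ) * t = (2 * n + 1) * t - t := by ring
    rw [e1, e2, cos_add, cos_sub]
    simp only [id, Pi.mul_apply]
    field_simp
    ring
  have := intervalIntegral.integral_eq_sub_of_hasDerivAt_of_le pi_pos.le hF hd
    ((((hi _).const_mul _).sub ((hi _).const_mul _)).add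
      (Continuous.intervalIntegrable (by fun_prop) _ _))
  rw [intervalIntegral.integral_add (((hi _).const_mul _).sub ((hi _).const_mul _))
      (Continuous.intervalIntegrable (by fun_prop) _ _),
    intervalIntegral.integral_sub ((hi _).const_mul _) ((hi _).const_mul _),
    intervalIntegral.integral_add (Continuous.intervalIntegrable (by fun_prop) _ _)
      (Continuous.intervalIntegrable (by fun_prop) _ _),
    intervalIntegral.integral_const_mul, intervalIntegral.integral_const_mul] at this
  have h3 : ∫ t in (0 : ℝ)..π, cos (2 * (n + 1) * t) = 0 := by
    have hn : (2 * ((n : ℝ) + 1)) ≠ 0 := by positivity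
    rw [intervalIntegral.integral_comp_mul_left (fun t => cos t) hn, integral_cos]
    have := sin_nat_mul_pi (2 * (n + 1))
    push_cast at this
    simp [this]
  have h4 : ∫ t in (0 : ℝ)..π, cos (2 * n * t) = if n = 0 then π else 0 := by
    split_ifs with h
    · simp [h]
    · have hn : (2 * (n : ℝ)) ≠ 0 := by positivity
      rw [intervalIntegral.integral_comp_mul_left (fun t => cos t) hn, integral_cos]
      have := sin_nat_mul_pi (2 * n)
      push_cast at this
      simp [this]
  rw [h3, h4] at this
  simp only [sin_pi, sin_zero, zero_mul, sub_zero] at this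
  linarith

open Real in
theorem integral_log_sin_mul_cos {n : ℕ} (hn : 1 ≤ n) :
    ∫ t in (0 : ℝ)..π, log (sin t) * cos (2 * n * t) = - π / (2 * n) := by
  have key : ∀ m : ℕ, 2 * ((m + 1 : ℕ) : ℝ) *
      (∫ t in (0 : ℝ)..π, log (sin t) * cos (2 * ((m + 1 : ℕ) : ℝ) * t)) = - π := by
    intro m
    induction m with
    | zero => have := two_mul_integral_log_sin_mul_cos_succ 0; push_cast at this ⊢; simpa using this
    | succ m ih =>
      have := two_mul_integral_log_sin_mul_cos_succ (m + 1)
      rw [ih] at this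
      push_cast at this ⊢
      simpa using this
  obtain ⟨m, rfl⟩ : ∃ m, n = m + 1 := ⟨n - 1, by omega⟩
  have hm : (2 * ((m + 1 : ℕ) : ℝ)) ≠ 0 := by positivity
  rw [eq_div_iff hm, mul_comm]
  exact key m

/-- The `2π`-periodic function `log |sin (t / 2)|`, whose Fourier coefficients diagonalise the
logarithmic kernel on `[-1, 1]`. -/
def logSinHalf (t : ℝ) : ℝ := Real.log (Real.sin (t / 2))

open Real in
theorem logSinHalf_periodic : Function.Periodic logSinHalf (2 * π) := by
  intro t
  unfold logSinHalf
  rw [show (t + 2 * π) / 2 = t / 2 + π by ring, sin_add_pi, log_neg_eq_log]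

open Real in
theorem logSinHalf_neg (t : ℝ) : logSinHalf (-t) = logSinHalf t := by
  unfold logSinHalf
  rw [neg_div, sin_neg, log_neg_eq_log]

open Real in
theorem intervalIntegrable_logSinHalf (a b : ℝ) : IntervalIntegrable logSinHalf volume a b := by
  have := (intervalIntegrable_log_sin (a := a / 2) (b := b / 2)).comp_mul_left (c := 1 / 2)
  convert this using 1
  · ext t; simp [logSinHalf, div_eq_inv_mul]
  · ring
  · ring

open Real in
theorem integral_logSinHalf_mul_cos {n : ℕ} (hn : 1 ≤ n) :
    ∫ t in (0 : ℝ)..2 * π, logSinHalf t * cos (n * t) = - π / n := by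
  have h := intervalIntegral.integral_comp_div (a := 0) (b := 2 * π)
    (fun t => log (sin t) * cos (2 * n * t)) (c := 2) two_ne_zero
  rw [zero_div, mul_div_cancel_left₀ _ two_ne_zero, integral_log_sin_mul_cos hn] at h
  have hn' : (n : ℝ) ≠ 0 := by positivity
  convert h using 1
  · refine intervalIntegral.integral_congr fun t _ => ?_
    simp only [logSinHalf]
    congr 2
    ring
  · simp only [smul_eq_mul]
    field_simp

open Real in
theorem integral_logSinHalf_mul_sin (n : ℕ) :
    ∫ t in (0 : ℝ)..2 * π, logSinHalf t * sin (n * t) = 0 := by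
  have h := intervalIntegral.integral_comp_sub_left (a := 0) (b := 2 * π)
    (fun t => logSinHalf t * sin (n * t)) (2 * π)
  have h2 : ∀ t, logSinHalf (2 * π - t) * sin (n * (2 * π - t)) =
      -(logSinHalf t * sin (n * t)) := by
    intro t
    rw [← logSinHalf_neg (2 * π - t), show -(2 * π - t) = t - 2 * π by ring,
      logSinHalf_periodic.sub_eq, show (n : ℝ) * (2 * π - t) = n * (2 * π) - n * t by ring,
      sin_nat_mul_two_pi_sub]
    ring
  simp only [h2, intervalIntegral.integral_neg, sub_self, sub_zero] at h
  linarith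

open Real in
theorem intervalIntegrable_logSinHalf_sub_mul (φ a b : ℝ) {f : ℝ → ℝ} (hf : Continuous f) :
    IntervalIntegrable (fun t => logSinHalf (t - φ) * f t) volume a b := by
  have := (intervalIntegrable_logSinHalf (a - φ) (b - φ)).comp_sub_right φ
  simp only [sub_add_cancel] at this
  exact this.mul_continuousOn hf.continuousOn

open Real in
theorem integral_logSinHalf_sub_mul (φ : ℝ) (f : ℝ → ℝ) (hf : Function.Periodic f (2 * π)) :
    ∫ t in (-π)..π, logSinHalf (t - φ) * f t = ∫ t in (0 : ℝ)..2 * π, logSinHalf t * f (t + φ) := by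
  have h := intervalIntegral.integral_comp_sub_right (a := -π) (b := π)
    (fun t => logSinHalf t * f (t + φ)) φ
  simp only [sub_add_cancel] at h
  rw [h]
  have hp : Function.Periodic (fun t => logSinHalf t * f (t + φ)) (2 * π) := by
    intro t
    simp only
    rw [logSinHalf_periodic, show t + 2 * π + φ = t + φ + 2 * π by ring, hf]
  have := hp.intervalIntegral_add_eq (-π - φ) 0
  rw [show -π - φ + 2 * π = π - φ by ring, zero_add] at this
  exact this

open Real in
theorem integral_logSinHalf_sub_mul_cos (φ : ℝ) {n : ℕ} (hn : 1 ≤ n) :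
    ∫ t in (-π)..π, logSinHalf (t - φ) * cos (n * t) = - π / n * cos (n * φ) := by
  rw [integral_logSinHalf_sub_mul φ (fun t => cos (n * t))]
  · have h : ∀ t, logSinHalf t * cos (n * (t + φ)) =
        cos (n * φ) * (logSinHalf t * cos (n * t)) -
          sin (n * φ) * (logSinHalf t * sin (n * t)) := by
      intro t
      rw [mul_add, cos_add]; ring
    simp only [h]
    have hi := intervalIntegrable_logSinHalf 0 (2 * π)
    rw [intervalIntegral.integral_sub, intervalIntegral.integral_const_mul,
      intervalIntegral.integral_const_mul, integral_logSinHalf_mul_cos hn,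
      integral_logSinHalf_mul_sin]
    · ring
    · exact (hi.mul_continuousOn (by fun_prop)).const_mul _
    · exact (hi.mul_continuousOn (by fun_prop)).const_mul _
  · intro t
    simp only [mul_add, cos_add_nat_mul_two_pi]

open Real in
theorem integral_logSinHalf_sub_mul_sin (φ : ℝ) {n : ℕ} (hn : 1 ≤ n) :
    ∫ t in (-π)..π, logSinHalf (t - φ) * sin (n * t) = - π / n * sin (n * φ) := by
  rw [integral_logSinHalf_sub_mul φ (fun t => sin (n * t))]
  · have h : ∀ t, logSinHalf t * sin (n * (t + φ)) =
        sin (n * φ) * (logSinHalf t * cos (n * t)) +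
          cos (n * φ) * (logSinHalf t * sin (n * t)) := by
      intro t
      rw [mul_add, sin_add]; ring
    simp only [h]
    have hi := intervalIntegrable_logSinHalf 0 (2 * π)
    rw [intervalIntegral.integral_add, intervalIntegral.integral_const_mul,
      intervalIntegral.integral_const_mul, integral_logSinHalf_mul_cos hn,
      integral_logSinHalf_mul_sin]
    · ring
    · exact (hi.mul_continuousOn (by fun_prop)).const_mul _
    · exact (hi.mul_continuousOn (by fun_prop)).const_mul _
  · intro t
    simp only [mul_add, sin_add_nat_mul_two_pi]

open Real in
/-- Folding `(-π, 0)` onto `(0, π)`. -/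
theorem integral_logSinHalf_add_mul (φ c : ℝ) (f : ℝ → ℝ) (hf : ∀ t, f (-t) = c * f t) :
    ∫ t in (0 : ℝ)..π, logSinHalf (t + φ) * f t =
      c * ∫ t in (-π)..0, logSinHalf (t - φ) * f t := by
  have h := intervalIntegral.integral_comp_neg (a := 0) (b := π)
    (fun t => logSinHalf (t - φ) * f t)
  rw [neg_zero] at h
  rw [← h, ← intervalIntegral.integral_const_mul]
  refine intervalIntegral.integral_congr fun t _ => ?_
  rw [hf, show -t - φ = -(t + φ) by ring, logSinHalf_neg]
  have := hf (-t)
  rw [neg_neg, hf] at this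
  linear_combination logSinHalf (t + φ) * this

open Real in
theorem cos_sub_cos_ne_zero {t φ : ℝ} (ht : t ∈ Icc 0 π) (hφ : φ ∈ Icc 0 π) (h : t ≠ φ) :
    cos φ - cos t ≠ 0 := by
  rw [sub_ne_zero]
  exact fun e => h (injOn_cos ht hφ e.symm)

open Real in
theorem sin_half_mul_sin_half_ne_zero {t φ : ℝ} (ht : t ∈ Icc 0 π) (hφ : φ ∈ Icc 0 π) (h : t ≠ φ) :
    sin ((t + φ) / 2) ≠ 0 ∧ sin ((t - φ) / 2) ≠ 0 := by
  have h1 := cos_sub_cos_ne_zero ht hφ h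
  have h2 := cos_sub_cos φ t
  rw [h2, add_comm φ t, show (φ - t) / 2 = -((t - φ) / 2) by ring, sin_neg] at h1
  constructor <;> intro h0 <;> simp [h0] at h1

open Real in
theorem log_cos_sub_cos {t φ : ℝ} (ht : t ∈ Icc 0 π) (hφ : φ ∈ Icc 0 π) (h : t ≠ φ) :
    log (cos φ - cos t) = log 2 + logSinHalf (t + φ) + logSinHalf (t - φ) := by
  obtain ⟨h1, h2⟩ := sin_half_mul_sin_half_ne_zero ht hφ h
  have h3 : cos φ - cos t = 2 * sin ((t + φ) / 2) * sin ((t - φ) / 2) := by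
    rw [cos_sub_cos φ t, add_comm φ t, show (φ - t) / 2 = -((t - φ) / 2) by ring, sin_neg]
    ring
  rw [h3, log_mul (by positivity) h2, log_mul two_ne_zero h1]
  rfl

open Real in
theorem intervalIntegrable_log_cos_sub_cos {φ : ℝ} (hφ : φ ∈ Icc 0 π) :
    IntervalIntegrable (fun t => log (cos φ - cos t)) volume 0 π := by
  have h1 := intervalIntegrable_logSinHalf_sub_mul φ 0 π (f := fun _ => 1) continuous_const
  have h2 := intervalIntegrable_logSinHalf_sub_mul (-φ) 0 π (f := fun _ => 1) continuous_const
  simp only [mul_one, sub_neg_eq_add] at h1 h2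
  refine (((intervalIntegrable_const (c := log 2)).add h2).add h1).congr_ae ?_
  rw [uIoc_of_le pi_pos.le]
  refine (ae_restrict_iff' measurableSet_Ioc).2 ?_
  filter_upwards [compl_mem_ae_iff.2 (measure_singleton φ)] with t ht htI
  exact (log_cos_sub_cos ⟨htI.1.le, htI.2⟩ hφ ht).symm

open Real in
/-- Against an even function, the kernel `log |cos φ - cos t|` on `(0, π)` unfolds to a convolution
with `log |sin (t / 2)|` over a full period. -/
theorem integral_log_cos_sub_cos_mul {φ : ℝ} (hφ : φ ∈ Icc 0 π) {f : ℝ → ℝ} (hc : Continuous f)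
    (hf : ∀ t, f (-t) = f t) :
    ∫ t in (0 : ℝ)..π, log (cos φ - cos t) * f t =
      log 2 * (∫ t in (0 : ℝ)..π, f t) + ∫ t in (-π)..π, logSinHalf (t - φ) * f t := by
  have e : ∫ t in (0 : ℝ)..π, log (cos φ - cos t) * f t =
      ∫ t in (0 : ℝ)..π, (log 2 * f t + logSinHalf (t + φ) * f t) +
        logSinHalf (t - φ) * f t := by
    refine intervalIntegral.integral_congr_ae ?_
    filter_upwards [compl_mem_ae_iff.2 (measure_singleton φ)] with t ht htI
    rw [uIoc_of_le pi_pos.le] at htI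
    rw [log_cos_sub_cos ⟨htI.1.le, htI.2⟩ hφ ht]
    ring
  have hi := intervalIntegrable_logSinHalf_sub_mul (-φ) 0 π hc
  simp only [sub_neg_eq_add] at hi
  have hf2 := (hc.const_mul (log 2)).intervalIntegrable (μ := volume) 0 π
  rw [e, intervalIntegral.integral_add (hf2.add hi)
      (intervalIntegrable_logSinHalf_sub_mul φ 0 π hc),
    intervalIntegral.integral_add hf2 hi,
    integral_logSinHalf_add_mul φ 1 _ (fun t => by rw [hf, one_mul]),
    intervalIntegral.integral_const_mul,
    one_mul, add_assoc, intervalIntegral.integral_add_adjacent_intervals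
      (intervalIntegrable_logSinHalf_sub_mul φ _ _ hc)
      (intervalIntegrable_logSinHalf_sub_mul φ _ _ hc)]

open Real in
/-- Chebyshev polynomials are eigenfunctions of the logarithmic kernel on `[-1, 1]` with the
arcsine weight, in the variable `t = arccos y`. -/
theorem integral_log_cos_sub_cos_mul_cos {φ : ℝ} (hφ : φ ∈ Icc 0 π) {n : ℕ} (hn : 1 ≤ n) :
    ∫ t in (0 : ℝ)..π, log (cos φ - cos t) * cos (n * t) = - π / n * cos (n * φ) := by
  rw [integral_log_cos_sub_cos_mul hφ (f := fun t => cos (n * t)) (by fun_prop)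
    (fun t => by simp), integral_logSinHalf_sub_mul_cos φ hn]
  have h0 : ∫ t in (0 : ℝ)..π, cos (n * t) = 0 := by
    have hn' : (n : ℝ) ≠ 0 := by positivity
    rw [intervalIntegral.integral_comp_mul_left (fun t => cos t) hn', integral_cos]
    simp
  rw [h0]; ring

open Real in
/-- A bound on `|log s|` whose integral can be computed. -/
theorem abs_log_le_of_abs_le_two {s : ℝ} (hs : |s| ≤ 2) : |log s| ≤ 2 * log 2 - log s := by
  have h2 : 0 ≤ log 2 := log_nonneg one_le_two
  rcases eq_or_ne s 0 with rfl | h0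
  · simp [h2]
  have : log |s| ≤ log 2 := log_le_log (abs_pos.2 h0) hs
  rw [log_abs] at this
  rw [abs_le]
  constructor <;> linarith

open Real in
/-- The logarithmic kernel is integrable in `t`, uniformly in `φ`; this justifies
Fubini's theorem. -/
theorem exists_integral_abs_log_cos_sub_cos_le : ∃ C, ∀ φ ∈ Icc 0 π,
    ∫ t in (0 : ℝ)..π, |log (cos φ - cos t)| ≤ C := by
  refine ⟨2 * log 2 * π - (log 2 * π + ∫ t in (0 : ℝ)..2 * π, logSinHalf t), fun φ hφ => ?_⟩
  have hi := intervalIntegrable_log_cos_sub_cos hφ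
  have h1 : ∫ t in (0 : ℝ)..π, |log (cos φ - cos t)| ≤
      ∫ t in (0 : ℝ)..π, (2 * log 2 - log (cos φ - cos t)) := by
    refine intervalIntegral.integral_mono_on pi_pos.le hi.norm
      (intervalIntegrable_const.sub hi) fun t _ => abs_log_le_of_abs_le_two ?_
    have h1 := abs_cos_le_one φ
    have h2 := abs_cos_le_one t
    rw [abs_le] at *
    constructor <;> linarith
  refine h1.trans (le_of_eq ?_)
  have h3 := integral_log_cos_sub_cos_mul hφ (f := fun _ => 1) continuous_const fun _ => rfl
  rw [integral_logSinHalf_sub_mul φ (fun _ => 1) fun _ => rfl] at h3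
  simp only [mul_one] at h3
  rw [intervalIntegral.integral_sub intervalIntegrable_const hi, h3]
  simp only [intervalIntegral.integral_const, smul_eq_mul]
  ring

/-! ### Sine coefficients of the Riesz Green function -/

open Real in
theorem arsinh_sin_mul_sin {t φ : ℝ} (ht : t ∈ Ioo 0 π) (hφ : φ ∈ Ioo 0 π) (h : t ≠ φ) :
    arsinh (√((1 - cos t ^ 2) * (1 - cos φ ^ 2) / (cos t - cos φ) ^ 2)) =
      logSinHalf (t + φ) - logSinHalf (t - φ) := by
  have ht' : t ∈ Icc 0 π := ⟨ht.1.le, ht.2.le⟩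
  have hφ' : φ ∈ Icc 0 π := ⟨hφ.1.le, hφ.2.le⟩
  obtain ⟨h1, h2⟩ := sin_half_mul_sin_half_ne_zero ht' hφ' h
  have hst := sin_pos_of_mem_Ioo ht
  have hsφ := sin_pos_of_mem_Ioo hφ
  have hA : 0 < sin ((t + φ) / 2) :=
    sin_pos_of_pos_of_lt_pi (by linarith [ht.1, hφ.1]) (by linarith [ht.2, hφ.2])
  set A := sin ((t + φ) / 2) with hAdef
  set B := |sin ((t - φ) / 2)| with hBdef
  have hB : 0 < B := abs_pos.2 h2
  have hB2 : B ^ 2 = sin ((t - φ) / 2) ^ 2 := sq_abs _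
  have hc : (cos t - cos φ) ^ 2 = (2 * A * B) ^ 2 := by
    rw [cos_sub_cos, mul_pow (2 * A), hB2, hAdef]; ring
  -- `sin t sin φ = A² - B²`
  have hss : sin t * sin φ = A ^ 2 - B ^ 2 := by
    rw [hB2, hAdef, sin_sq_eq_half_sub, sin_sq_eq_half_sub, mul_div_cancel₀ _ two_ne_zero,
      mul_div_cancel₀ _ two_ne_zero, cos_add, cos_sub]
    ring
  have hx : √((1 - cos t ^ 2) * (1 - cos φ ^ 2) / (cos t - cos φ) ^ 2) =
      (A / B - (A / B)⁻¹) / 2 := by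
    rw [← sin_sq, ← sin_sq, ← mul_pow, hc, ← div_pow, sqrt_sq (by positivity), hss]
    field_simp
  have hl : (A / B - (A / B)⁻¹) / 2 = sinh (log (A / B)) := by
    rw [sinh_eq, exp_neg, exp_log (by positivity)]
  rw [hx, hl, arsinh_sinh, log_div hA.ne' hB.ne', hBdef, log_abs]
  rfl

open Real in
/-- The Riesz Green function in the variables `t = arccos x`, `φ = arccos y`. -/
theorem rieszG_cos {t φ : ℝ} (ht : t ∈ Ioo 0 π) (hφ : φ ∈ Ioo 0 π) (h : t ≠ φ) :
    rieszG (cos t) (cos φ) = π⁻¹ * (logSinHalf (t + φ) - logSinHalf (t - φ)) := by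
  have hcos : ∀ {s : ℝ}, s ∈ Ioo 0 π → cos s ∈ Ioo (-1 : ℝ) 1 := fun {s} hs =>
    ⟨by simpa using cos_lt_cos_of_nonneg_of_le_pi hs.1.le le_rfl hs.2,
     by simpa using cos_lt_cos_of_nonneg_of_le_pi le_rfl hs.2.le hs.1⟩
  rw [rieszG, if_pos ⟨hcos ht, hcos hφ⟩, arsinh_sin_mul_sin ht hφ h]

open Real in
theorem intervalIntegrable_rieszG_cos_mul {φ : ℝ} (hφ : φ ∈ Ioo 0 π) {f : ℝ → ℝ}
    (hf : Continuous f) :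
    IntervalIntegrable (fun t => rieszG (cos t) (cos φ) * f t) volume 0 π := by
  have h1 := intervalIntegrable_logSinHalf_sub_mul φ 0 π hf
  have h2 := intervalIntegrable_logSinHalf_sub_mul (-φ) 0 π hf
  simp only [sub_neg_eq_add] at h2
  refine ((h2.sub h1).const_mul π⁻¹).congr_ae ?_
  rw [uIoc_of_le pi_pos.le, ← restrict_Ioo_eq_restrict_Ioc]
  refine (ae_restrict_iff' measurableSet_Ioo).2 ?_
  filter_upwards [compl_mem_ae_iff.2 (measure_singleton φ)] with t ht htI
  rw [rieszG_cos htI hφ ht]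
  ring

open Real in
theorem integral_rieszG_cos_mul_sin {φ : ℝ} (hφ : φ ∈ Ioo 0 π) {n : ℕ} (hn : 1 ≤ n) :
    ∫ t in (0 : ℝ)..π, rieszG (cos t) (cos φ) * sin (n * t) = sin (n * φ) / n := by
  have hc : Continuous fun t : ℝ => sin (n * t) := by fun_prop
  have e : ∫ t in (0 : ℝ)..π, rieszG (cos t) (cos φ) * sin (n * t) =
      ∫ t in (0 : ℝ)..π, π⁻¹ * (logSinHalf (t + φ) * sin (n * t) -
        logSinHalf (t - φ) * sin (n * t)) := by
    rw [intervalIntegral.integral_of_le pi_pos.le, intervalIntegral.integral_of_le pi_pos.le,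
      integral_Ioc_eq_integral_Ioo, integral_Ioc_eq_integral_Ioo]
    refine setIntegral_congr_ae measurableSet_Ioo ?_
    filter_upwards [compl_mem_ae_iff.2 (measure_singleton φ)] with t ht htI
    rw [rieszG_cos htI hφ ht]
    ring
  have hi := intervalIntegrable_logSinHalf_sub_mul (-φ) 0 π hc
  simp only [sub_neg_eq_add] at hi
  have hadd := intervalIntegral.integral_add_adjacent_intervals
      (intervalIntegrable_logSinHalf_sub_mul φ (-π) 0 hc)
      (intervalIntegrable_logSinHalf_sub_mul φ 0 π hc)
  rw [integral_logSinHalf_sub_mul_sin φ hn] at hadd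
  rw [e, intervalIntegral.integral_const_mul,
    intervalIntegral.integral_sub hi (intervalIntegrable_logSinHalf_sub_mul φ 0 π hc),
    integral_logSinHalf_add_mul φ (-1) _ (fun t => by simp)]
  have hpi := pi_pos.ne'
  have hn' : (n : ℝ) ≠ 0 := by positivity
  rw [show -1 * (∫ t in (-π)..0, logSinHalf (t - φ) * sin (n * t)) -
    (∫ t in (0 : ℝ)..π, logSinHalf (t - φ) * sin (n * t)) = π / n * sin (n * φ) by
      linear_combination -hadd]
  field_simp

/-! ### Chebyshev moments of the fundamental solution -/

open Real in
/-- The Chebyshev moment of `x ↦ (y - x) G(x, y)` at `y = cos φ`, in the variable `t = arccos x`. -/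
theorem integral_sub_mul_rieszG_cos_mul {φ : ℝ} (hφ : φ ∈ Ioo 0 π) {n : ℕ} (hn : 3 ≤ n) :
    ∫ t in (0 : ℝ)..π, (cos φ - cos t) * rieszG (cos t) (cos φ) * sin t * cos (n * t) =
      1 / 2 * (cos φ * (sin ((n + 1) * φ) / (n + 1) - sin ((n - 1) * φ) / (n - 1)) -
        1 / 2 * (sin ((n + 2) * φ) / (n + 2) - sin ((n - 2) * φ) / (n - 2))) := by
  obtain ⟨m, rfl⟩ : ∃ m, n = m + 3 := ⟨n - 3, by omega⟩
  have hI := fun k : ℕ => fun hk : 1 ≤ k => integral_rieszG_cos_mul_sin hφ hk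
  have hii := fun k : ℕ =>
    intervalIntegrable_rieszG_cos_mul hφ (f := fun t => sin (k * t)) (by fun_prop)
  have e : ∀ t, (cos φ - cos t) * rieszG (cos t) (cos φ) * sin t * cos ((m + 3 : ℕ) * t) =
      cos φ / 2 * (rieszG (cos t) (cos φ) * sin ((m + 4 : ℕ) * t))
      - cos φ / 2 * (rieszG (cos t) (cos φ) * sin ((m + 2 : ℕ) * t))
      - (1 / 4 * (rieszG (cos t) (cos φ) * sin ((m + 5 : ℕ) * t))
      - 1 / 4 * (rieszG (cos t) (cos φ) * sin ((m + 1 : ℕ) * t))) := by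
    intro t
    have h4 : ((m + 4 : ℕ) : ℝ) * t = (m + 3 : ℕ) * t + t := by push_cast; ring
    have h2 : ((m + 2 : ℕ) : ℝ) * t = (m + 3 : ℕ) * t - t := by push_cast; ring
    have h5 : ((m + 5 : ℕ) : ℝ) * t = (m + 3 : ℕ) * t + 2 * t := by push_cast; ring
    have h1 : ((m + 1 : ℕ) : ℝ) * t = (m + 3 : ℕ) * t - 2 * t := by push_cast; ring
    rw [h4, h2, h5, h1, sin_add, sin_sub, sin_add, sin_sub, sin_two_mul]
    ring
  simp only [e]
  rw [intervalIntegral.integral_sub (((hii _).const_mul _).sub ((hii _).const_mul _))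
      (((hii _).const_mul _).sub ((hii _).const_mul _)),
    intervalIntegral.integral_sub ((hii _).const_mul _) ((hii _).const_mul _),
    intervalIntegral.integral_sub ((hii _).const_mul _) ((hii _).const_mul _)]
  simp only [intervalIntegral.integral_const_mul]
  rw [hI _ (by omega), hI _ (by omega), hI _ (by omega), hI _ (by omega)]
  push_cast
  rw [show (m : ℝ) + 3 + 1 = m + 4 by ring, show (m : ℝ) + 3 - 1 = m + 2 by ring,
    show (m : ℝ) + 3 + 2 = m + 5 by ring, show (m : ℝ) + 3 - 2 = m + 1 by ring]
  ring

open Real in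
theorem integral_cos_natCast_mul {k : ℕ} (hk : 1 ≤ k) (φ : ℝ) :
    ∫ t in (0 : ℝ)..φ, cos (k * t) = sin (k * φ) / k := by
  have hk' : (k : ℝ) ≠ 0 := by positivity
  rw [intervalIntegral.integral_comp_mul_left (fun t => cos t) hk', integral_cos]
  simp [div_eq_inv_mul]

open Real in
/-- The Chebyshev moment of `y ↦ (y - a)₊² / 2` at `a = cos φ` with the arcsine weight agrees,
up to the factor `n`, with that of `x ↦ (a - x) G(x, a)`. -/
theorem integral_sq_sub_cos_mul (φ : ℝ) {n : ℕ} (hn : 3 ≤ n) :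
    n * ∫ t in (0 : ℝ)..φ, (cos t - cos φ) ^ 2 / 2 * cos (n * t) =
      1 / 2 * (cos φ * (sin ((n + 1) * φ) / (n + 1) - sin ((n - 1) * φ) / (n - 1)) -
        1 / 2 * (sin ((n + 2) * φ) / (n + 2) - sin ((n - 2) * φ) / (n - 2))) := by
  obtain ⟨m, rfl⟩ : ∃ m, n = m + 3 := ⟨n - 3, by omega⟩
  have hI := fun k : ℕ => fun hk : 1 ≤ k => integral_cos_natCast_mul hk φ
  have hii : ∀ k : ℕ, ∀ c : ℝ,
      IntervalIntegrable (fun t : ℝ => c * cos (k * t)) volume 0 φ := fun k c =>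
    Continuous.intervalIntegrable (by fun_prop) _ _
  have e : ∀ t, (cos t - cos φ) ^ 2 / 2 * cos ((m + 3 : ℕ) * t) =
      (1 / 4 + cos φ ^ 2 / 2) * cos ((m + 3 : ℕ) * t) +
      (1 / 8 * cos ((m + 5 : ℕ) * t) + 1 / 8 * cos ((m + 1 : ℕ) * t))
      - (cos φ / 2 * cos ((m + 4 : ℕ) * t) + cos φ / 2 * cos ((m + 2 : ℕ) * t)) := by
    intro t
    have h4 : ((m + 4 : ℕ) : ℝ) * t = (m + 3 : ℕ) * t + t := by push_cast; ring
    have h2 : ((m + 2 : ℕ) : ℝ) * t = (m + 3 : ℕ) * t - t := by push_cast; ring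
    have h5 : ((m + 5 : ℕ) : ℝ) * t = (m + 3 : ℕ) * t + 2 * t := by push_cast; ring
    have h1 : ((m + 1 : ℕ) : ℝ) * t = (m + 3 : ℕ) * t - 2 * t := by push_cast; ring
    rw [h4, h2, h5, h1, cos_add, cos_sub, cos_add, cos_sub, cos_two_mul]
    ring
  simp only [e]
  rw [intervalIntegral.integral_sub ((hii _ _).add ((hii _ _).add (hii _ _)))
      ((hii _ _).add (hii _ _)),
    intervalIntegral.integral_add (hii _ _) ((hii _ _).add (hii _ _)),
    intervalIntegral.integral_add (hii _ _) (hii _ _),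
    intervalIntegral.integral_add (hii _ _) (hii _ _)]
  simp only [intervalIntegral.integral_const_mul]
  rw [hI _ (by omega), hI _ (by omega), hI _ (by omega), hI _ (by omega), hI _ (by omega)]
  have h4 : ((m + 4 : ℕ) : ℝ) * φ = (m + 3 : ℕ) * φ + φ := by push_cast; ring
  have h2 : ((m + 2 : ℕ) : ℝ) * φ = (m + 3 : ℕ) * φ - φ := by push_cast; ring
  have h5 : ((m + 5 : ℕ) : ℝ) * φ = (m + 3 : ℕ) * φ + 2 * φ := by push_cast; ring
  have h1 : ((m + 1 : ℕ) : ℝ) * φ = (m + 3 : ℕ) * φ - 2 * φ := by push_cast; ring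
  rw [h4, h2, h5, h1]
  rw [show (((m + 3 : ℕ) : ℝ) + 1) * φ = (m + 3 : ℕ) * φ + φ by ring,
    show (((m + 3 : ℕ) : ℝ) - 1) * φ = (m + 3 : ℕ) * φ - φ by ring,
    show (((m + 3 : ℕ) : ℝ) + 2) * φ = (m + 3 : ℕ) * φ + 2 * φ by ring,
    show (((m + 3 : ℕ) : ℝ) - 2) * φ = (m + 3 : ℕ) * φ - 2 * φ by ring,
    sin_add, sin_sub, sin_add, sin_sub, sin_two_mul, cos_two_mul]
  push_cast
  rw [show (m : ℝ) + 3 + 1 = m + 4 by ring, show (m : ℝ) + 3 - 1 = m + 2 by ring,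
    show (m : ℝ) + 3 + 2 = m + 5 by ring, show (m : ℝ) + 3 - 2 = m + 1 by ring]
  have n1 : (m : ℝ) + 1 ≠ 0 := by positivity
  have n2 : (m : ℝ) + 2 ≠ 0 := by positivity
  have n3 : (m : ℝ) + 3 ≠ 0 := by positivity
  have n4 : (m : ℝ) + 4 ≠ 0 := by positivity
  have n5 : (m : ℝ) + 5 ≠ 0 := by positivity
  generalize sin (((m : ℝ) + 3) * φ) = S
  generalize cos (((m : ℝ) + 3) * φ) = C
  field_simp
  ring

open Polynomial.Chebyshev (measureT integral_measureT integrable_measureT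
  integral_measureT_eq_integral_cos)

/-! ### The arcsine measure -/

instance isFiniteMeasure_measureT : IsFiniteMeasure measureT := by
  have := integrable_measureT (f := fun _ => (1 : ℝ)) continuousOn_const
  exact (integrable_const_iff_isFiniteMeasure one_ne_zero).1 this

theorem measureT_absolutelyContinuous : measureT ≪ volume :=
  Measure.absolutelyContinuous_of_le Measure.restrict_le_self |>.trans
    (withDensity_absolutelyContinuous _ _)

theorem ae_measureT_mem_Ioo : ∀ᵐ y ∂measureT, y ∈ Ioo (-1 : ℝ) 1 := by
  have h1 : ∀ᵐ y ∂measureT, y ∈ Ioc (-1 : ℝ) 1 := by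
    rw [measureT]; exact ae_restrict_mem measurableSet_Ioc
  have h2 : ∀ᵐ y ∂measureT, y ≠ 1 :=
    measureT_absolutelyContinuous.ae_le (compl_mem_ae_iff.2 (measure_singleton 1))
  filter_upwards [h1, h2] with y hy hy1
  exact ⟨hy.1, lt_of_le_of_ne hy.2 hy1⟩

open Real in
/-- The arcsine measure is the image of Lebesgue measure on `(0, π]` under `cos`; in contrast to
`integral_measureT_eq_integral_cos`, this transfers integrability. -/
theorem measureT_eq_map_cos : measureT = (volume.restrict (Ioc 0 π)).map cos := by
  ext s hs
  have h1 : measureT.real s = ((volume.restrict (Ioc 0 π)).map cos).real s := by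
    rw [← integral_indicator_one hs, ← integral_indicator_one hs,
      integral_measureT_eq_integral_cos, intervalIntegral.integral_of_le pi_pos.le,
      integral_map (by fun_prop) ((measurable_one.indicator hs).aestronglyMeasurable)]
  rwa [measureReal_def, measureReal_def, ENNReal.toReal_eq_toReal_iff' (measure_ne_top _ _)
    (measure_ne_top _ _)] at h1

open Real in
theorem integrable_measureT_iff {f : ℝ → ℝ} (hf : Measurable f) :
    Integrable f measureT ↔ IntervalIntegrable (fun t => f (cos t)) volume 0 π := by
  rw [measureT_eq_map_cos, intervalIntegrable_iff_integrableOn_Ioc_of_le pi_pos.le,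
    integrable_map_measure hf.aestronglyMeasurable (by fun_prop)]
  rfl

/-- Lebesgue measure on `(-1, 1)` in terms of the arcsine measure. -/
theorem integral_mul_sqrt_measureT (f : ℝ → ℝ) :
    ∫ y, f y * √(1 - y ^ 2) ∂measureT = ∫ y in Ioo (-1 : ℝ) 1, f y := by
  rw [integral_measureT, intervalIntegral.integral_of_le (by norm_num),
    integral_Ioc_eq_integral_Ioo]
  refine setIntegral_congr_fun measurableSet_Ioo fun y hy => ?_
  have : 0 < √(1 - y ^ 2) := Real.sqrt_pos.2 (by nlinarith [hy.1, hy.2])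
  simp only [Real.sqrt_inv]
  field_simp

theorem setIntegral_Ioo_eq_integral {f : ℝ → ℝ} (hf : ∀ y ∉ Ioo (-1 : ℝ) 1, f y = 0) :
    ∫ y in Ioo (-1 : ℝ) 1, f y = ∫ y, f y :=
  setIntegral_eq_integral_of_forall_compl_eq_zero hf

theorem measurable_log_sub : Measurable fun p : ℝ × ℝ => Real.log (p.1 - p.2) := by
  fun_prop

theorem exists_eq_cos {x : ℝ} (hx : x ∈ Icc (-1 : ℝ) 1) :
    ∃ φ ∈ Icc 0 Real.pi, x = Real.cos φ :=
  ⟨Real.arccos x, ⟨Real.arccos_nonneg x, Real.arccos_le_pi x⟩, (Real.cos_arccos hx.1 hx.2).symm⟩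

theorem integrable_log_sub_measureT {x : ℝ} (hx : x ∈ Icc (-1 : ℝ) 1) :
    Integrable (fun y => Real.log (x - y)) measureT := by
  obtain ⟨φ, hφ, rfl⟩ := exists_eq_cos hx
  exact (integrable_measureT_iff (by fun_prop)).2 (intervalIntegrable_log_cos_sub_cos hφ)

theorem exists_integral_abs_log_sub_le : ∃ C, ∀ x ∈ Icc (-1 : ℝ) 1,
    ∫ y, |Real.log (x - y)| ∂measureT ≤ C := by
  obtain ⟨C, hC⟩ := exists_integral_abs_log_cos_sub_cos_le
  refine ⟨C, fun x hx => ?_⟩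
  obtain ⟨φ, hφ, rfl⟩ := exists_eq_cos hx
  rw [integral_measureT_eq_integral_cos]
  exact hC φ hφ

/-- The Chebyshev polynomials are the eigenfunctions of the logarithmic kernel with respect to the
arcsine measure. -/
theorem integral_log_sub_mul_T {x : ℝ} (hx : x ∈ Icc (-1 : ℝ) 1) {n : ℕ} (hn : 1 ≤ n) :
    ∫ y, Real.log (x - y) * (Polynomial.Chebyshev.T ℝ n).eval y ∂measureT =
      -Real.pi / n * (Polynomial.Chebyshev.T ℝ n).eval x := by
  obtain ⟨φ, hφ, rfl⟩ := exists_eq_cos hx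
  rw [integral_measureT_eq_integral_cos, Polynomial.Chebyshev.T_real_cos]
  simp only [Polynomial.Chebyshev.T_real_cos, Int.cast_natCast]
  exact integral_log_cos_sub_cos_mul_cos hφ hn

/-! ### Logarithmic potentials -/

/-- The logarithmic potential `y ↦ ∫ u(x) log |x - y| dx` of a density `u`
(recall that `Real.log s = log |s|`). -/
def logPotential (u : ℝ → ℝ) (y : ℝ) : ℝ := ∫ x, u x * Real.log (x - y)

theorem integrable_mul_log_sub_prod {u : ℝ → ℝ} (hu : Integrable u)
    (hu0 : ∀ x ∉ Ioo (-1 : ℝ) 1, u x = 0) :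
    Integrable (fun p : ℝ × ℝ => u p.1 * Real.log (p.1 - p.2)) (volume.prod measureT) := by
  obtain ⟨C, hC⟩ := exists_integral_abs_log_sub_le
  have hm : AEStronglyMeasurable (fun p : ℝ × ℝ => u p.1 * Real.log (p.1 - p.2))
      (volume.prod measureT) :=
    hu.aestronglyMeasurable.comp_fst.mul measurable_log_sub.aestronglyMeasurable
  rw [integrable_prod_iff hm]
  constructor
  · refine .of_forall fun x => ?_
    by_cases hx : x ∈ Ioo (-1 : ℝ) 1
    · exact (integrable_log_sub_measureT (Ioo_subset_Icc_self hx)).const_mul (u x)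
    · simp [hu0 x hx]
  · refine (hu.norm.mul_const C).mono' hm.norm.integral_prod_right' (.of_forall fun x => ?_)
    rw [Real.norm_of_nonneg (integral_nonneg fun _ => norm_nonneg _)]
    simp only [norm_mul]
    rw [integral_const_mul]
    by_cases hx : x ∈ Ioo (-1 : ℝ) 1
    · exact mul_le_mul_of_nonneg_left (hC x (Ioo_subset_Icc_self hx)) (norm_nonneg _)
    · simp [hu0 x hx]

theorem integrable_logPotential {u : ℝ → ℝ} (hu : Integrable u)
    (hu0 : ∀ x ∉ Ioo (-1 : ℝ) 1, u x = 0) : Integrable (logPotential u) measureT :=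
  (integrable_mul_log_sub_prod hu hu0).integral_prod_right

theorem integrable_mul_log_sub_mul_prod {u : ℝ → ℝ} (hu : Integrable u)
    (hu0 : ∀ x ∉ Ioo (-1 : ℝ) 1, u x = 0) {f : ℝ → ℝ} (hf : Continuous f) :
    Integrable (fun p : ℝ × ℝ => u p.1 * (Real.log (p.1 - p.2) * f p.2))
      (volume.prod measureT) := by
  obtain ⟨B, hB⟩ := (isCompact_Icc (a := (-1 : ℝ)) (b := 1)).exists_bound_of_continuousOn
    hf.continuousOn
  simp only [← mul_assoc]
  refine (integrable_mul_log_sub_prod hu hu0).mul_bdd (c := B)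
    (hf.comp continuous_snd).aestronglyMeasurable ?_
  have : ∀ᵐ y ∂measureT, ‖f y‖ ≤ B := by
    filter_upwards [ae_measureT_mem_Ioo] with y hy using hB y (Ioo_subset_Icc_self hy)
  exact Measure.quasiMeasurePreserving_snd.ae this

theorem integral_mul_integral_log_measureT {u : ℝ → ℝ} (hu : Integrable u)
    (hu0 : ∀ x ∉ Ioo (-1 : ℝ) 1, u x = 0) {f : ℝ → ℝ} (hf : Continuous f) :
    ∫ x, u x * ∫ y, Real.log (x - y) * f y ∂measureT =
      ∫ y, logPotential u y * f y ∂measureT := by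
  have := integral_integral_swap (f := fun x y => u x * (Real.log (x - y) * f y))
    (integrable_mul_log_sub_mul_prod hu hu0 hf)
  simp only [logPotential, ← integral_mul_const, ← integral_const_mul]
  simpa only [mul_assoc] using this

theorem integral_log_mul_sqrt_measureT {f : ℝ → ℝ} (hf0 : ∀ y ∉ Ioo (-1 : ℝ) 1, f y = 0) (x : ℝ) :
    ∫ y, Real.log (x - y) * (f y * √(1 - y ^ 2)) ∂measureT = ∫ y, Real.log (x - y) * f y := by
  simp only [← mul_assoc]
  rw [integral_mul_sqrt_measureT, setIntegral_Ioo_eq_integral fun y hy => by simp [hf0 y hy]]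

theorem integrable_mul_integral_log {u : ℝ → ℝ} (hu : Integrable u)
    (hu0 : ∀ x ∉ Ioo (-1 : ℝ) 1, u x = 0) {f : ℝ → ℝ} (hf : Continuous f)
    (hf0 : ∀ y ∉ Ioo (-1 : ℝ) 1, f y = 0) :
    Integrable fun x => u x * ∫ y, Real.log (x - y) * f y := by
  have := (integrable_mul_log_sub_mul_prod hu hu0
    (f := fun y => f y * √(1 - y ^ 2)) (by fun_prop)).integral_prod_left
  simpa only [integral_const_mul, integral_log_mul_sqrt_measureT hf0] using this

/-- Fubini's theorem for the logarithmic kernel, against Lebesgue measure. The right-hand side is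
`∫ L_u f` over `(-1, 1)`, written with the arcsine measure. -/
theorem integral_mul_integral_log {u : ℝ → ℝ} (hu : Integrable u)
    (hu0 : ∀ x ∉ Ioo (-1 : ℝ) 1, u x = 0) {f : ℝ → ℝ} (hf : Continuous f)
    (hf0 : ∀ y ∉ Ioo (-1 : ℝ) 1, f y = 0) :
    ∫ x, u x * ∫ y, Real.log (x - y) * f y =
      ∫ y, logPotential u y * (f y * √(1 - y ^ 2)) ∂measureT := by
  rw [← integral_mul_integral_log_measureT hu hu0 (by fun_prop)]
  simp only [integral_log_mul_sqrt_measureT hf0]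

/-! ### The multiplier `|ξ|` and the logarithmic kernel -/

/-- The multiplier `|ξ|`, damped at scale `1 / t`. -/
def dampedAbs (t ξ : ℝ) : ℝ := |ξ| * Real.exp (-(2 * Real.pi * t * |ξ|))

theorem integrable_dampedAbs {t : ℝ} (ht : 0 < t) : Integrable (dampedAbs t) := by
  have h := (integrable_fun_norm_addHaar (E := ℝ) (F := ℝ) volume
    (f := fun r => r * Real.exp (-(2 * Real.pi * t * r)))).2 ?_
  · simpa [dampedAbs, funext_iff, Function.comp_def] using! h
  · have := integrableOn_rpow_mul_exp_neg_mul_rpow (p := 1) (s := 1) (b := 2 * Real.pi * t)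
      (by norm_num) one_pos (by positivity)
    simpa using this

theorem integral_mul_cexp_neg_mul_Ioi {c : ℂ} (hc : 0 < c.re)
    (hi : IntegrableOn (fun x : ℝ => (x : ℂ) * Complex.exp (-(c * x))) (Ioi 0)) :
    ∫ x in Ioi (0 : ℝ), (x : ℂ) * Complex.exp (-(c * x)) = 1 / c ^ 2 := by
  have hc0 : c ≠ 0 := fun h => by simp [h] at hc
  have hd : ∀ x : ℝ, HasDerivAt
      (fun x : ℝ => -((x : ℂ) / c + 1 / c ^ 2) * Complex.exp (-(c * x)))
      ((x : ℂ) * Complex.exp (-(c * x))) x := by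
    intro x
    have h1 : HasDerivAt (fun x : ℝ => (x : ℂ)) 1 x := Complex.ofRealCLM.hasDerivAt
    have h2 := (((h1.div_const c).add_const (1 / c ^ 2)).neg).mul ((h1.const_mul c).neg.cexp)
    refine h2.congr_deriv ?_
    simp only [Pi.neg_apply]
    field_simp
    ring
  have hlim : Tendsto (fun x : ℝ => -((x : ℂ) / c + 1 / c ^ 2) * Complex.exp (-(c * x)))
      atTop (𝓝 0) := by
    have h1 : Tendsto (fun x : ℝ => x * Real.exp (-(c.re * x))) atTop (𝓝 0) := by
      have := tendsto_rpow_mul_exp_neg_mul_atTop_nhds_zero 1 c.re hc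
      simpa using this
    have h0 : Tendsto (fun x : ℝ => Real.exp (-(c.re * x))) atTop (𝓝 0) := by
      have := tendsto_rpow_mul_exp_neg_mul_atTop_nhds_zero 0 c.re hc
      simpa using this
    refine squeeze_zero_norm' (a := fun x : ℝ => ‖c‖⁻¹ * (x * Real.exp (-(c.re * x))) +
      (‖c‖ ^ 2)⁻¹ * Real.exp (-(c.re * x))) ?_ ?_
    · filter_upwards [eventually_ge_atTop 0] with x hx
      rw [norm_mul, norm_neg, Complex.norm_exp]
      have e1 : (-(c * (x : ℂ))).re = -(c.re * x) := by simp
      rw [e1, ← mul_assoc, ← add_mul]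
      gcongr
      refine (norm_add_le _ _).trans (le_of_eq ?_)
      simp [abs_of_nonneg hx, div_eq_inv_mul]
    · simpa using (h1.const_mul ‖c‖⁻¹).add (h0.const_mul (‖c‖ ^ 2)⁻¹)
  have := integral_Ioi_of_hasDerivAt_of_tendsto' (fun x _ => hd x) hi hlim
  rw [this]
  simp

/-- The Fourier transform of the damped multiplier `|ξ| e^{-2πt|ξ|}`. -/
theorem integral_dampedAbs_mul_cexp {t : ℝ} (ht : 0 < t) (s : ℝ) :
    ∫ ξ, (dampedAbs t ξ : ℂ) * Complex.exp (2 * Real.pi * Complex.I * (s * ξ)) =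
      (((1 / (2 * Real.pi ^ 2)) * ((t ^ 2 - s ^ 2) / (t ^ 2 + s ^ 2) ^ 2) : ℝ) : ℂ) := by
  have hint : ∀ s : ℝ, Integrable fun ξ : ℝ => (dampedAbs t ξ : ℂ) *
      Complex.exp (2 * Real.pi * Complex.I * (s * ξ)) := by
    intro s
    refine (integrable_dampedAbs ht).ofReal.mul_bdd (c := 1)
      (Continuous.aestronglyMeasurable (by fun_prop)) (.of_forall fun ξ => ?_)
    rw [Complex.norm_exp]
    simp
  have hhalf : ∀ s : ℝ, ∫ ξ in Ioi (0 : ℝ), (dampedAbs t ξ : ℂ) *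
      Complex.exp (2 * Real.pi * Complex.I * (s * ξ)) =
        1 / (2 * Real.pi * (t - Complex.I * s)) ^ 2 := by
    intro s
    have e : ∀ ξ ∈ Ioi (0 : ℝ), (dampedAbs t ξ : ℂ) *
        Complex.exp (2 * Real.pi * Complex.I * (s * ξ)) =
          (ξ : ℂ) * Complex.exp (-(2 * Real.pi * (t - Complex.I * s) * ξ)) := by
      intro ξ hξ
      rw [dampedAbs, abs_of_pos hξ]
      push_cast
      rw [mul_assoc, ← Complex.exp_add]
      congr 2
      ring
    rw [setIntegral_congr_fun measurableSet_Ioi e]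
    refine integral_mul_cexp_neg_mul_Ioi ?_ ?_
    · have : (2 * (Real.pi : ℂ) * (t - Complex.I * s)).re = 2 * Real.pi * t := by
        simp
      rw [this]; positivity
    · exact (hint s).integrableOn.congr_fun e measurableSet_Ioi
  rw [← intervalIntegral.integral_Iic_add_Ioi (b := 0) (hint s).integrableOn (hint s).integrableOn,
    hhalf s]
  have hneg := integral_comp_neg_Ioi (0 : ℝ) (fun ξ : ℝ => (dampedAbs t ξ : ℂ) *
      Complex.exp (2 * Real.pi * Complex.I * (s * ξ)))
  rw [neg_zero] at hneg
  rw [← hneg]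
  have e : ∀ ξ : ℝ, (dampedAbs t (-ξ) : ℂ) *
      Complex.exp (2 * Real.pi * Complex.I * (s * ((-ξ : ℝ) : ℂ))) = (dampedAbs t ξ : ℂ) *
      Complex.exp (2 * Real.pi * Complex.I * (((-s : ℝ) : ℂ) * ξ)) := by
    intro ξ
    simp [dampedAbs]
  simp only [e]
  rw [hhalf (-s)]
  push_cast
  have hpi : (Real.pi : ℂ) ≠ 0 := by exact_mod_cast Real.pi_ne_zero
  have h1 : (t : ℂ) - Complex.I * s ≠ 0 := by
    intro h; have := congrArg Complex.re h; simp at this; exact ht.ne' this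
  have h2 : (t : ℂ) + Complex.I * s ≠ 0 := by
    intro h; have := congrArg Complex.re h; simp at this; exact ht.ne' this
  have h3 : (t : ℂ) ^ 2 + s ^ 2 = (t - Complex.I * s) * (t + Complex.I * s) := by
    linear_combination (s : ℂ) ^ 2 * Complex.I_sq
  have h4 : (t : ℂ) ^ 2 - s ^ 2 =
      ((t - Complex.I * s) ^ 2 + (t + Complex.I * s) ^ 2) / 2 := by
    linear_combination -(s : ℂ) ^ 2 * Complex.I_sq
  rw [h3, h4, mul_neg, sub_neg_eq_add]
  field_simp

theorem hasDerivAt_half_log {t : ℝ} (ht : 0 < t) (x y : ℝ) :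
    HasDerivAt (fun y => 1 / 2 * Real.log (t ^ 2 + (x - y) ^ 2))
      (-(x - y) / (t ^ 2 + (x - y) ^ 2)) y := by
  have hp : t ^ 2 + (x - y) ^ 2 ≠ 0 := by positivity
  have h := (((((hasDerivAt_id y).const_sub x).pow 2).const_add (t ^ 2)).log hp).const_mul (1 / 2)
  refine h.congr_deriv ?_
  simp only [id, Pi.pow_apply]
  field_simp
  ring

theorem hasDerivAt_deriv_half_log {t : ℝ} (ht : 0 < t) (x y : ℝ) :
    HasDerivAt (fun y => -(x - y) / (t ^ 2 + (x - y) ^ 2))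
      ((t ^ 2 - (x - y) ^ 2) / (t ^ 2 + (x - y) ^ 2) ^ 2) y := by
  have hp : t ^ 2 + (x - y) ^ 2 ≠ 0 := by positivity
  have h := (((hasDerivAt_id y).const_sub x).neg).div
    ((((hasDerivAt_id y).const_sub x).pow 2).const_add (t ^ 2)) hp
  refine h.congr_deriv ?_
  simp only [id, Pi.neg_apply, Pi.pow_apply]
  congr 1
  push_cast
  ring

theorem integral_mul_deriv_eq_neg {φ v v' : ℝ → ℝ} (hφ : ContDiff ℝ 1 φ) (hφc : HasCompactSupport φ)
    (hv : ∀ y, HasDerivAt v (v' y) y) (hv' : Continuous v') :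
    ∫ y, φ y * v' y = -∫ y, deriv φ y * v y := by
  have hvc : Continuous v := continuous_iff_continuousAt.2 fun y => (hv y).continuousAt
  have hd : Continuous (deriv φ) := hφ.continuous_deriv le_rfl
  refine integral_mul_deriv_eq_deriv_mul_of_integrable
    (fun y _ => (hφ.differentiable one_ne_zero y).hasDerivAt) (fun y _ => hv y) ?_ ?_ ?_
  · exact (hφ.continuous.mul hv').integrable_of_hasCompactSupport hφc.mul_right
  · exact (hd.mul hvc).integrable_of_hasCompactSupport hφc.deriv.mul_right
  · exact (hφ.continuous.mul hvc).integrable_of_hasCompactSupport hφc.mul_right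

/-- The Fourier transform of the damped multiplier is, up to a constant, the second derivative of
`½ log (t² + s²)`. -/
theorem integral_mul_kernel_eq {φ : ℝ → ℝ} (hφ : ContDiff ℝ 2 φ) (hφc : HasCompactSupport φ)
    {t : ℝ} (ht : 0 < t) (x : ℝ) :
    ∫ y, φ y * ((t ^ 2 - (x - y) ^ 2) / (t ^ 2 + (x - y) ^ 2) ^ 2) =
      ∫ y, deriv (deriv φ) y * (1 / 2 * Real.log (t ^ 2 + (x - y) ^ 2)) := by
  have hp : ∀ y, t ^ 2 + (x - y) ^ 2 ≠ 0 := fun y => by positivity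
  have hφ' : ContDiff ℝ 1 (deriv φ) := (contDiff_succ_iff_deriv (n := 1).1 hφ).2.2
  rw [integral_mul_deriv_eq_neg (hφ.of_le one_le_two) hφc (hasDerivAt_deriv_half_log ht x),
    integral_mul_deriv_eq_neg hφ' hφc.deriv (hasDerivAt_half_log ht x), neg_neg]
  · exact Continuous.div (by fun_prop) (by fun_prop) hp
  · exact Continuous.div (by fun_prop) (by fun_prop) fun y => pow_ne_zero 2 (hp y)

theorem locallyIntegrable_log_sub (x : ℝ) : LocallyIntegrable fun y => Real.log (x - y) := by
  have h : ∀ a b : ℝ, IntervalIntegrable (fun y => Real.log (x - y)) volume a b := by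
    intro a b
    have := (intervalIntegral.intervalIntegrable_log' (a := x - a) (b := x - b)).comp_sub_left x
    simpa using this
  intro y
  refine ⟨Ioc (y - 1) (y + 1), Ioc_mem_nhds (by linarith) (by linarith), ?_⟩
  exact (intervalIntegrable_iff_integrableOn_Ioc_of_le (by linarith)).1 (h _ _)

theorem tendsto_integral_half_log {f : ℝ → ℝ} (hf : Continuous f) (hfc : HasCompactSupport f)
    (x : ℝ) :
    Tendsto (fun t => ∫ y, f y * (1 / 2 * Real.log (t ^ 2 + (x - y) ^ 2))) (𝓝[>] 0)
      (𝓝 (∫ y, Real.log (x - y) * f y)) := by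
  have hb : Integrable fun y => |Real.log (x - y) * f y| +
      |f y| * (1 / 2 * Real.log (1 + (x - y) ^ 2)) := by
    refine Integrable.add ?_ ?_
    · exact ((locallyIntegrable_log_sub x).integrable_smul_right_of_hasCompactSupport hf hfc).norm
    · have : Continuous fun y => |f y| * (1 / 2 * Real.log (1 + (x - y) ^ 2)) := by
        refine hf.abs.mul (continuous_const.mul (Continuous.log (by fun_prop) fun y => ?_))
        positivity
      exact this.integrable_of_hasCompactSupport hfc.norm.mul_right
  refine tendsto_integral_filter_of_dominated_convergence _ ?_ ?_ hb ?_
  · refine .of_forall fun t => (Measurable.aestronglyMeasurable ?_)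
    have := hf.measurable
    fun_prop
  · filter_upwards [Ioo_mem_nhdsGT (zero_lt_one' ℝ)] with t ht
    filter_upwards [compl_mem_ae_iff.2 (measure_singleton x)] with y hy
    have hxy : x - y ≠ 0 := sub_ne_zero.2 fun h => hy h.symm
    have h1 : Real.log (x - y) ≤ 1 / 2 * Real.log (t ^ 2 + (x - y) ^ 2) := by
      have := Real.log_le_log (x := (x - y) ^ 2) (y := t ^ 2 + (x - y) ^ 2) (by positivity)
        (by nlinarith [sq_nonneg t])
      rw [Real.log_pow] at this
      push_cast at this
      linarith
    have h2 : 1 / 2 * Real.log (t ^ 2 + (x - y) ^ 2) ≤ 1 / 2 * Real.log (1 + (x - y) ^ 2) := by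
      have := Real.log_le_log (x := t ^ 2 + (x - y) ^ 2) (y := 1 + (x - y) ^ 2) (by positivity)
        (by nlinarith [ht.1, ht.2])
      linarith
    have h3 : 0 ≤ Real.log (1 + (x - y) ^ 2) := Real.log_nonneg (by nlinarith [sq_nonneg (x - y)])
    rw [Real.norm_eq_abs, abs_mul (f y), abs_mul (Real.log (x - y)), mul_comm _ |f y|, ← mul_add]
    refine mul_le_mul_of_nonneg_left ?_ (abs_nonneg _)
    rw [abs_le]
    have h4 := neg_abs_le (Real.log (x - y))
    have h5 := abs_nonneg (Real.log (x - y))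
    constructor <;> linarith
  · filter_upwards [compl_mem_ae_iff.2 (measure_singleton x)] with y hy
    have hxy : x - y ≠ 0 := sub_ne_zero.2 fun h => hy h.symm
    have hc : ContinuousAt (fun t : ℝ => f y * (1 / 2 * Real.log (t ^ 2 + (x - y) ^ 2))) 0 := by
      refine continuousAt_const.mul (continuousAt_const.mul (ContinuousAt.log (by fun_prop) ?_))
      positivity
    have h := hc.tendsto.mono_left (nhdsWithin_le_nhds (s := Ioi 0))
    convert h using 2
    rw [zero_pow two_ne_zero, zero_add, Real.log_pow]
    push_cast
    ring

theorem integrable_abs_mul_schwartz (f : 𝓢(ℝ, ℂ)) :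
    Integrable fun ξ : ℝ => ((|2 * Real.pi * ξ| : ℝ) : ℂ) * f ξ := by
  refine ((f.integrable_pow_mul volume 1).const_mul (2 * Real.pi)).mono'
    (Continuous.aestronglyMeasurable ?_) (.of_forall fun ξ => ?_)
  · have := f.continuous
    fun_prop
  · simp only [norm_mul, Complex.norm_real, Real.norm_eq_abs, abs_abs, abs_mul,
      abs_of_pos Real.pi_pos, pow_one]
    rw [abs_two]
    exact (mul_assoc _ _ _).le

/-- Convolution with the logarithmic kernel inverts the multiplier: on compactly supported
functions `|D| φ = (1/π) log|·| * φ''`. -/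
theorem fourier_abs_mul_fourierInv {φ : ℝ → ℝ} (hφ : ContDiff ℝ 2 φ) (hφc : HasCompactSupport φ)
    {ψ : 𝓢(ℝ, ℂ)} (hψ : ∀ y, ψ y = (φ y : ℂ)) (x : ℝ) :
    𝓕 (fun ξ : ℝ => ((|2 * Real.pi * ξ| : ℝ) : ℂ) * (𝓕⁻ ψ : 𝓢(ℝ, ℂ)) ξ) x =
      ((Real.pi⁻¹ * ∫ y, Real.log (x - y) * deriv (deriv φ) y : ℝ) : ℂ) := by
  set m : ℝ → ℂ := fun ξ : ℝ => ((|2 * Real.pi * ξ| : ℝ) : ℂ) * (𝓕⁻ ψ : 𝓢(ℝ, ℂ)) ξ with hm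
  have hmc : Continuous m := by
    have := (𝓕⁻ ψ : 𝓢(ℝ, ℂ)).continuous
    fun_prop
  have hmi : Integrable m := integrable_abs_mul_schwartz _
  -- the identity for the damped multiplier, by the self-adjointness of the Fourier transform
  have hk : ∀ t : ℝ, 0 < t →
      ∫ ξ, Complex.exp (((-2 * Real.pi * inner ℝ ξ x : ℝ) : ℂ) * Complex.I) •
        ((Real.exp (-(2 * Real.pi * t * |ξ|)) : ℂ) * m ξ) =
      ((Real.pi⁻¹ *
        ∫ y, deriv (deriv φ) y * (1 / 2 * Real.log (t ^ 2 + (x - y) ^ 2)) : ℝ) : ℂ) := by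
    intro t ht
    set h : ℝ → ℂ := fun ξ => Complex.exp (((-2 * Real.pi * inner ℝ ξ x : ℝ) : ℂ) * Complex.I) *
      (dampedAbs t ξ : ℂ) with hh
    have hhi : Integrable h := by
      refine (integrable_dampedAbs ht).ofReal.bdd_mul (c := 1)
        (Continuous.aestronglyMeasurable (by fun_prop)) (.of_forall fun ξ => ?_)
      rw [Complex.norm_exp]
      simp
    have hflip := VectorFourier.integral_fourierIntegral_smul_eq_flip (L := -innerₗ ℝ)
      (μ := (volume : Measure ℝ)) (ν := (volume : Measure ℝ)) (f := ψ) (g := h)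
      Real.continuous_fourierChar (by simp; fun_prop) ψ.integrable hhi
    have e1 : ∫ ξ, Complex.exp (((-2 * Real.pi * inner ℝ ξ x : ℝ) : ℂ) * Complex.I) •
        ((Real.exp (-(2 * Real.pi * t * |ξ|)) : ℂ) * m ξ) =
        2 * Real.pi * ∫ ξ, 𝓕⁻ (ψ : ℝ → ℂ) ξ • h ξ := by
      rw [← integral_const_mul]
      congr with ξ
      simp only [hm, hh, dampedAbs, smul_eq_mul, abs_mul, abs_two, abs_of_pos Real.pi_pos,
        SchwartzMap.fourierInv_coe]
      push_cast
      ring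
    have e2 : ∫ ξ, 𝓕⁻ (ψ : ℝ → ℂ) ξ • h ξ = ∫ y, ψ y • 𝓕⁻ h y := by
      refine hflip.trans ?_
      congr with y
      congr 1
      rw [Real.fourierInv_eq, VectorFourier.fourierIntegral]
      congr with ξ
      simp [mul_comm]
    have e3 : ∀ y, 𝓕⁻ h y =
        (((1 / (2 * Real.pi ^ 2)) *
          ((t ^ 2 - (x - y) ^ 2) / (t ^ 2 + (x - y) ^ 2) ^ 2) : ℝ) : ℂ) := by
      intro y
      rw [← neg_sub y x, neg_sq, ← integral_dampedAbs_mul_cexp ht, Real.fourierInv_eq']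
      congr with ξ
      simp only [hh, smul_eq_mul]
      rw [← mul_assoc, ← Complex.exp_add, mul_comm]
      congr 2
      simp
      ring
    rw [e1, e2]
    simp only [e3, hψ, smul_eq_mul]
    have e4 : ∫ y, (φ y : ℂ) * (((1 / (2 * Real.pi ^ 2)) *
        ((t ^ 2 - (x - y) ^ 2) / (t ^ 2 + (x - y) ^ 2) ^ 2) : ℝ) : ℂ) =
        (((1 / (2 * Real.pi ^ 2)) *
          ∫ y, φ y * ((t ^ 2 - (x - y) ^ 2) / (t ^ 2 + (x - y) ^ 2) ^ 2) : ℝ) : ℂ) := by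
      rw [← integral_const_mul, ← integral_complex_ofReal]
      congr with y
      push_cast
      ring
    rw [e4, integral_mul_kernel_eq hφ hφc ht]
    push_cast
    have hpi : (Real.pi : ℂ) ≠ 0 := by exact_mod_cast Real.pi_ne_zero
    field_simp
  have hL : Tendsto (fun t : ℝ => ∫ ξ,
      Complex.exp (((-2 * Real.pi * inner ℝ ξ x : ℝ) : ℂ) * Complex.I) •
        ((Real.exp (-(2 * Real.pi * t * |ξ|)) : ℂ) * m ξ)) (𝓝[>] 0) (𝓝 (𝓕 m x)) := by
    rw [Real.fourier_eq']
    refine tendsto_integral_filter_of_dominated_convergence (fun ξ => ‖m ξ‖) ?_ ?_ hmi.norm ?_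
    · exact .of_forall fun t => Continuous.aestronglyMeasurable (by fun_prop)
    · filter_upwards [self_mem_nhdsWithin] with t ht
      refine .of_forall fun ξ => ?_
      rw [norm_smul, Complex.norm_exp, norm_mul, Complex.norm_real]
      have h1 : Real.exp (-(2 * Real.pi * t * |ξ|)) ≤ 1 := by
        rw [Real.exp_le_one_iff]
        have := Real.pi_pos
        have : 0 < t := ht
        have := abs_nonneg ξ
        rw [neg_nonpos]; positivity
      have h2 : (((-2 * Real.pi * inner ℝ ξ x : ℝ) : ℂ) * Complex.I).re = 0 := by
        rw [Complex.re_ofReal_mul]; simp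
      rw [h2, Real.exp_zero, one_mul, Real.norm_of_nonneg (Real.exp_pos _).le]
      exact mul_le_of_le_one_left (norm_nonneg _) h1
    · refine .of_forall fun ξ => ?_
      have hc : Continuous fun t : ℝ =>
          Complex.exp (((-2 * Real.pi * inner ℝ ξ x : ℝ) : ℂ) * Complex.I) •
            ((Real.exp (-(2 * Real.pi * t * |ξ|)) : ℂ) * m ξ) := by fun_prop
      have := (hc.tendsto 0).mono_left (nhdsWithin_le_nhds (s := Ioi 0))
      simpa using this
  refine tendsto_nhds_unique hL ?_
  have hφ' : ContDiff ℝ 1 (deriv φ) := (contDiff_succ_iff_deriv (n := 1).1 hφ).2.2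
  have hR := ((tendsto_integral_half_log (hφ'.continuous_deriv le_rfl) hφc.deriv.deriv
    x).const_mul Real.pi⁻¹)
  refine ((Complex.continuous_ofReal.tendsto _).comp hR).congr' ?_
  filter_upwards [self_mem_nhdsWithin] with t ht
  exact (hk t ht).symm

/-- The action of `I(u)` on a test function, through the logarithmic kernel. -/
theorem opI_apply_eq {u : ℝ → ℝ} (hu : Integrable u) {φ : ℝ → ℝ} (hφ : ContDiff ℝ 2 φ)
    (hφc : HasCompactSupport φ) {ψ : 𝓢(ℝ, ℂ)} (hψ : ∀ y, ψ y = (φ y : ℂ)) :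
    opI u ψ =
      ((-(Real.pi⁻¹ * ∫ x, u x * ∫ y, Real.log (x - y) * deriv (deriv φ) y) : ℝ) : ℂ) := by
  rw [opI_apply]
  set m : ℝ → ℂ := fun ξ : ℝ => ((|2 * Real.pi * ξ| : ℝ) : ℂ) * (𝓕⁻ ψ : 𝓢(ℝ, ℂ)) ξ with hm
  have hmi : Integrable m := integrable_abs_mul_schwartz _
  have hflip := VectorFourier.integral_fourierIntegral_smul_eq_flip (L := innerₗ ℝ)
      (μ := (volume : Measure ℝ)) (ν := (volume : Measure ℝ)) (f := fun x => (u x : ℂ)) (g := m)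
      Real.continuous_fourierChar (by simp; fun_prop) hu.ofReal hmi
  have e1 : ∫ ξ, (𝓕⁻ ψ : 𝓢(ℝ, ℂ)) ξ • symbolI u ξ =
      -∫ ξ, 𝓕 (fun x : ℝ => (u x : ℂ)) ξ • m ξ := by
    rw [← integral_neg]
    congr with ξ
    simp only [symbolI, hm, smul_eq_mul]
    ring
  have e2 : ∫ ξ, 𝓕 (fun x : ℝ => (u x : ℂ)) ξ • m ξ = ∫ x, (u x : ℂ) • 𝓕 m x := by
    refine hflip.trans ?_
    rw [flip_innerₗ]
    rfl
  rw [e1, e2, Complex.ofReal_neg, ← integral_const_mul, ← integral_complex_ofReal]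
  congr with x
  rw [fourier_abs_mul_fourierInv hφ hφc hψ]
  push_cast
  rw [smul_eq_mul]
  ring

/-! ### Test functions on `(-1, 1)` and du Bois-Reymond's lemma -/

theorem coe_lineDeriv_test {Ω : Opens ℝ} (φ : 𝓓(Ω, ℝ)) :
    ⇑(∂_{(1 : ℝ)} φ : 𝓓(Ω, ℝ)) = deriv φ := by
  ext x
  rw [TestFunction.lineDerivOp_eq_lineDerivCLM ℝ, TestFunction.lineDerivCLM_apply_of_le (by simp)]
  exact ((φ.contDiff.differentiable (by simp)) x).lineDeriv_eq_fderiv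

theorem test_eq_zero {φ : 𝓓(symmInterval, ℝ)} {x : ℝ} (hx : x ∉ Ioo (-1 : ℝ) 1) : φ x = 0 :=
  image_eq_zero_of_notMem_tsupport fun h => hx (φ.tsupport_subset h)

theorem integrable_mul_test {Ω : Opens ℝ} {p : ℝ → ℝ} (hp : Continuous p) (φ : 𝓓(Ω, ℝ)) :
    Integrable fun y => p y * φ y :=
  (hp.mul φ.continuous).integrable_of_hasCompactSupport φ.hasCompactSupport.mul_left

theorem exists_test_integral_eq_one : ∃ η : 𝓓(symmInterval, ℝ), ∫ y, η y = 1 := by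
  let f : ContDiffBump (0 : ℝ) := ⟨1 / 4, 1 / 2, by norm_num, by norm_num⟩
  refine ⟨⟨f.normed volume, f.contDiff_normed, f.hasCompactSupport_normed, ?_⟩, f.integral_normed⟩
  rw [f.tsupport_normed_eq, Real.closedBall_eq_Icc]
  intro x hx
  change x ∈ Ioo (-1 : ℝ) 1
  have hr : f.rOut = 1 / 2 := rfl
  rw [hr] at hx
  constructor <;> linarith [hx.1, hx.2]

/-- A test function with vanishing integral has a primitive that is a test function. -/
theorem exists_lineDeriv_eq {h : 𝓓(symmInterval, ℝ)} (h0 : ∫ y, h y = 0) :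
    ∃ φ : 𝓓(symmInterval, ℝ), ∂_{(1 : ℝ)} φ = h := by
  obtain ⟨r, hr1, hr⟩ : ∃ r < 1, tsupport h ⊆ Metric.ball (0 : ℝ) r := by
    refine exists_lt_subset_ball (isClosed_tsupport _) (h.tsupport_subset.trans ?_)
    rw [Real.ball_eq_Ioo]
    simp [symmInterval]
  rw [Real.ball_eq_Ioo, zero_sub, zero_add] at hr
  have hz : ∀ y ∉ Ioo (-r) r, h y = 0 := fun y hy =>
    image_eq_zero_of_notMem_tsupport fun hy' => hy (hr hy')
  have hint : Integrable h := h.continuous.integrable_of_hasCompactSupport h.hasCompactSupport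
  let F : ℝ → ℝ := fun x => ∫ y in (-1 : ℝ)..x, h y
  have hd : ∀ x, HasDerivAt F (h x) x := fun x =>
    intervalIntegral.integral_hasDerivAt_right hint.intervalIntegrable
      (h.continuous.stronglyMeasurableAtFilter _ _) h.continuous.continuousAt
  have hderiv : deriv F = h := funext fun x => (hd x).deriv
  have hsupp : Function.support F ⊆ Icc (-r) r := by
    intro x hx
    by_contra hx'
    apply hx
    rw [mem_Icc, not_and_or, not_le, not_le] at hx'
    have hh : ∀ y ∉ Ioc (-1 : ℝ) x, x > r → h y = 0 := fun y hy hxr => by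
      refine hz y fun hy' => hy ⟨by linarith [hy'.1], by linarith [hy'.2]⟩
    rcases hx' with hlt | hgt
    · refine intervalIntegral.integral_zero_ae (.of_forall fun y hy => hz y fun hy' => ?_)
      rcases le_total (-1) x with h1 | h1
      · rw [uIoc_of_le h1] at hy; linarith [hy.2, hy'.1]
      · rw [uIoc_of_ge h1] at hy; linarith [hy.2, hy'.1]
    · rcases le_total (-1) x with h1 | h1
      · change ∫ y in (-1 : ℝ)..x, h y = 0
        rw [intervalIntegral.integral_of_le h1,
          setIntegral_eq_integral_of_forall_compl_eq_zero fun y hy => hh y hy hgt, h0]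
      · refine intervalIntegral.integral_zero_ae (.of_forall fun y hy => hz y fun hy' => ?_)
        linarith [hy'.1, hy'.2]
  have htsupp : tsupport F ⊆ Icc (-r) r := closure_minimal hsupp isClosed_Icc
  refine ⟨⟨F, ?_, HasCompactSupport.of_support_subset_isCompact isCompact_Icc hsupp,
    htsupp.trans fun x hx => ?_⟩, ?_⟩
  · rw [contDiff_infty_iff_deriv]
    exact ⟨fun x => (hd x).differentiableAt, hderiv ▸ h.contDiff⟩
  · change x ∈ Ioo (-1 : ℝ) 1
    exact ⟨by linarith [hx.1], by linarith [hx.2]⟩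
  · apply DFunLike.coe_injective
    rw [coe_lineDeriv_test]
    exact hderiv

/-- du Bois-Reymond's lemma. -/
theorem exists_eq_const_mul_integral (Λ : 𝓓(symmInterval, ℝ) →ₗ[ℝ] ℝ)
    (h : ∀ φ : 𝓓(symmInterval, ℝ), Λ (∂_{(1 : ℝ)} φ) = 0) :
    ∃ c, ∀ φ, Λ φ = ∫ y, c * φ y := by
  obtain ⟨η, hη⟩ := exists_test_integral_eq_one
  refine ⟨Λ η, fun φ => ?_⟩
  have h1 : ∫ y, (φ - (∫ y, φ y) • η) y = 0 := by
    simp only [_root_.sub_apply, _root_.smul_apply, smul_eq_mul]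
    rw [integral_sub (φ.continuous.integrable_of_hasCompactSupport φ.hasCompactSupport)
      (integrable_mul_test continuous_const η), integral_const_mul, hη, mul_one, sub_self]
  obtain ⟨χ, hχ⟩ := exists_lineDeriv_eq h1
  have h2 := h χ
  rw [hχ, map_sub, map_smul, smul_eq_mul, sub_eq_zero] at h2
  rw [h2, integral_const_mul, mul_comm]

/-- A linear functional whose derivative is the function `-p` is itself a primitive of `-p`. -/
theorem exists_eq_integral_of_lineDeriv (Λ : 𝓓(symmInterval, ℝ) →ₗ[ℝ] ℝ) {p P : ℝ → ℝ}
    (hp : Continuous p) (hP : ∀ y, HasDerivAt P (p y) y)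
    (h : ∀ φ : 𝓓(symmInterval, ℝ), Λ (∂_{(1 : ℝ)} φ) = ∫ y, p y * φ y) :
    ∃ c, ∀ φ, Λ φ = ∫ y, (c - P y) * φ y := by
  have hPc : Continuous P := continuous_iff_continuousAt.2 fun y => (hP y).continuousAt
  let Q : 𝓓(symmInterval, ℝ) →ₗ[ℝ] ℝ :=
    { toFun := fun φ => ∫ y, P y * φ y
      map_add' := fun φ ψ => by
        simp only [_root_.add_apply, mul_add]
        exact integral_add (integrable_mul_test hPc φ) (integrable_mul_test hPc ψ)
      map_smul' := fun c φ => by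
        simp only [_root_.smul_apply, smul_eq_mul, mul_left_comm, RingHom.id_apply]
        exact integral_const_mul _ _ }
  obtain ⟨c, hc⟩ := exists_eq_const_mul_integral (Λ + Q) fun φ => by
    have := integral_mul_deriv_eq_neg (φ.contDiff.of_le (by simp)) φ.hasCompactSupport hP hp
    have e : Q (∂_{(1 : ℝ)} φ) = ∫ y, deriv φ y * P y := by
      simp only [Q, LinearMap.coe_mk, AddHom.coe_mk, coe_lineDeriv_test, mul_comm]
    rw [LinearMap.add_apply, h, e]
    simp only [mul_comm (p _), this]
    ring
  refine ⟨c, fun φ => ?_⟩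
  have h1 := hc φ
  rw [LinearMap.add_apply, ← eq_sub_iff_add_eq] at h1
  simp only [sub_mul]
  rw [integral_sub (integrable_mul_test continuous_const φ) (integrable_mul_test hPc φ), h1]
  rfl

/-- A linear functional on test functions that vanishes on third derivatives is given by a
quadratic polynomial. -/
theorem exists_eq_integral_quadratic (Λ : 𝓓(symmInterval, ℝ) →ₗ[ℝ] ℝ)
    (h : ∀ φ : 𝓓(symmInterval, ℝ), Λ (∂_{(1 : ℝ)} (∂_{(1 : ℝ)} (∂_{(1 : ℝ)} φ))) = 0) :
    ∃ a b c : ℝ, ∀ φ, Λ φ = ∫ y, (a + b * y + c * y ^ 2) * φ y := by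
  let D : 𝓓(symmInterval, ℝ) →ₗ[ℝ] 𝓓(symmInterval, ℝ) :=
    (LineDeriv.lineDerivOpCLM ℝ 𝓓(symmInterval, ℝ) (1 : ℝ)).toLinearMap
  have hD : ∀ φ, D φ = ∂_{(1 : ℝ)} φ := fun φ => rfl
  obtain ⟨c₀, h₀⟩ := exists_eq_const_mul_integral (Λ ∘ₗ D ∘ₗ D) h
  obtain ⟨c₁, h₁⟩ := exists_eq_integral_of_lineDeriv (Λ ∘ₗ D) (p := fun _ => c₀)
    (P := fun y => c₀ * y) continuous_const
    (fun y => by simpa using (hasDerivAt_id y).const_mul c₀) h₀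
  obtain ⟨c₂, h₂⟩ := exists_eq_integral_of_lineDeriv Λ (p := fun y => c₁ - c₀ * y)
    (P := fun y => c₁ * y - c₀ / 2 * y ^ 2) (by fun_prop)
    (fun y => by
      refine (((hasDerivAt_id y).const_mul c₁).sub
        (((hasDerivAt_id y).pow 2).const_mul (c₀ / 2))).congr_deriv ?_
      simp only [id]
      push_cast
      ring) h₁
  refine ⟨c₂, -c₁, c₀ / 2, fun φ => ?_⟩
  rw [h₂]
  congr with y
  ring

/-- The equation of `IsGreenSolution`, in terms of the logarithmic kernel. -/
theorem equation_iff {u : ℝ → ℝ} (hu : Integrable u) (z : ℝ) :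
    (∂_{(1 : ℝ)} (restrictDistribution symmInterval (opI u)) =
      Distribution.mapCLM Complex.ofRealCLM
        ((1 / 2 : ℝ) • (Distribution.delta z - Distribution.delta (-z) : 𝓓'(symmInterval, ℝ)))) ↔
    ∀ φ : 𝓓(symmInterval, ℝ), ∫ x, u x * ∫ y, Real.log (x - y) *
      (∂_{(1 : ℝ)} (∂_{(1 : ℝ)} (∂_{(1 : ℝ)} φ)) : 𝓓(symmInterval, ℝ)) y =
        Real.pi / 2 * (φ z - φ (-z)) := by
  have hL : ∀ φ : 𝓓(symmInterval, ℝ),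
      (∂_{(1 : ℝ)} (restrictDistribution symmInterval (opI u))) φ =
        ((Real.pi⁻¹ * ∫ x, u x * ∫ y, Real.log (x - y) *
          (∂_{(1 : ℝ)} (∂_{(1 : ℝ)} (∂_{(1 : ℝ)} φ)) : 𝓓(symmInterval, ℝ)) y : ℝ) : ℂ) := by
    intro φ
    rw [Distribution.lineDerivOp_apply_apply, map_neg]
    have := opI_apply_eq hu (φ := ⇑(∂_{(1 : ℝ)} φ : 𝓓(symmInterval, ℝ)))
      (contDiff_infty.1 (∂_{(1 : ℝ)} φ : 𝓓(symmInterval, ℝ)).contDiff 2)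
      (∂_{(1 : ℝ)} φ : 𝓓(symmInterval, ℝ)).hasCompactSupport
      (ψ := testToSchwartzCLM symmInterval (∂_{(1 : ℝ)} φ)) (fun y => rfl)
    rw [← coe_lineDeriv_test, ← coe_lineDeriv_test] at this
    change -(opI u (testToSchwartzCLM symmInterval (∂_{(1 : ℝ)} φ))) = _
    rw [this]
    push_cast
    ring
  have hR : ∀ φ : 𝓓(symmInterval, ℝ), (Distribution.mapCLM Complex.ofRealCLM
        ((1 / 2 : ℝ) • (Distribution.delta z - Distribution.delta (-z) : 𝓓'(symmInterval, ℝ)))) φ =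
      ((1 / 2 * (φ z - φ (-z)) : ℝ) : ℂ) := by
    intro φ
    rw [Distribution.mapCLM_apply]
    change ((1 / 2 : ℝ) • ((Distribution.delta z : 𝓓'(symmInterval, ℝ)) φ -
      (Distribution.delta (-z) : 𝓓'(symmInterval, ℝ)) φ) : ℝ) = (_ : ℂ)
    rw [Distribution.delta_apply, Distribution.delta_apply, smul_eq_mul]
  have hpi := Real.pi_ne_zero
  constructor
  · intro h φ
    have := DFunLike.congr_fun h φ
    rw [hL, hR, Complex.ofReal_inj] at this
    field_simp at this ⊢
    linarith
  · intro h
    ext φ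
    rw [hL, hR, h, Complex.ofReal_inj]
    field_simp

/-! ### Chebyshev moments -/

theorem integrable_mul_of_ae_mem_Icc {ν : Measure ℝ} {h f : ℝ → ℝ} (hh : Integrable h ν)
    (hν : ∀ᵐ y ∂ν, y ∈ Icc (-1 : ℝ) 1) (hf : Continuous f) : Integrable (fun y => h y * f y) ν := by
  obtain ⟨B, hB⟩ := (isCompact_Icc (a := (-1 : ℝ)) (b := 1)).exists_bound_of_continuousOn
    hf.continuousOn
  exact hh.mul_bdd (c := B) hf.aestronglyMeasurable (hν.mono hB)

/-- The Chebyshev polynomials span all polynomials. -/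
theorem mem_of_T_mem {S : Submodule ℝ (Polynomial ℝ)}
    (hS : ∀ n : ℕ, Polynomial.Chebyshev.T ℝ n ∈ S) (p : Polynomial ℝ) : p ∈ S := by
  have hX : ∀ q ∈ Submodule.span ℝ (Set.range fun n : ℕ => Polynomial.Chebyshev.T ℝ n),
      Polynomial.X * q ∈ Submodule.span ℝ (Set.range fun n : ℕ => Polynomial.Chebyshev.T ℝ n) := by
    intro q hq
    induction hq using Submodule.span_induction with
    | mem x hx =>
      obtain ⟨n, rfl⟩ := hx
      rcases n with _ | n
      · exact Submodule.subset_span ⟨1, by simp⟩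
      · have h := Polynomial.Chebyshev.T_add_two ℝ (n : ℤ)
        have e : Polynomial.X * Polynomial.Chebyshev.T ℝ ((n + 1 : ℕ) : ℤ) =
            (1 / 2 : ℝ) • Polynomial.Chebyshev.T ℝ ((n + 2 : ℕ) : ℤ) +
              (1 / 2 : ℝ) • Polynomial.Chebyshev.T ℝ (n : ℤ) := by
          push_cast
          rw [h, ← smul_add, sub_add_cancel, mul_assoc,
            show (2 : Polynomial ℝ) = Polynomial.C 2 from rfl, ← Polynomial.smul_eq_C_mul,
            smul_smul]
          norm_num
        simp only
        rw [e]
        exact Submodule.add_mem _ (Submodule.smul_mem _ _ (Submodule.subset_span ⟨n + 2, rfl⟩))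
          (Submodule.smul_mem _ _ (Submodule.subset_span ⟨n, rfl⟩))
    | zero => simp
    | add x y _ _ hx hy => rw [mul_add]; exact Submodule.add_mem _ hx hy
    | smul c x _ hx => rw [mul_smul_comm]; exact Submodule.smul_mem _ _ hx
  have hpow : ∀ n : ℕ, (Polynomial.X ^ n : Polynomial ℝ) ∈
      Submodule.span ℝ (Set.range fun n : ℕ => Polynomial.Chebyshev.T ℝ n) := by
    intro n
    induction n with
    | zero => exact Submodule.subset_span ⟨0, by simp⟩
    | succ n ih => rw [pow_succ']; exact hX _ ih
  have hle : Submodule.span ℝ (Set.range fun n : ℕ => Polynomial.Chebyshev.T ℝ n) ≤ S :=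
    Submodule.span_le.2 (by rintro _ ⟨n, rfl⟩; exact hS n)
  rw [p.as_sum_range_C_mul_X_pow]
  refine Submodule.sum_mem _ fun i _ => ?_
  rw [← Polynomial.smul_eq_C_mul]
  exact S.smul_mem _ (hle (hpow i))

/-- Densities on `[-1, 1]` with the same Chebyshev moments define the same functional on continuous
functions. -/
theorem integral_mul_eq_of_moments_eq {ν₁ ν₂ : Measure ℝ} {h₁ h₂ : ℝ → ℝ}
    (hh₁ : Integrable h₁ ν₁) (hh₂ : Integrable h₂ ν₂)
    (hν₁ : ∀ᵐ y ∂ν₁, y ∈ Icc (-1 : ℝ) 1) (hν₂ : ∀ᵐ y ∂ν₂, y ∈ Icc (-1 : ℝ) 1)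
    (hT : ∀ n : ℕ, ∫ y, h₁ y * (Polynomial.Chebyshev.T ℝ n).eval y ∂ν₁ =
      ∫ y, h₂ y * (Polynomial.Chebyshev.T ℝ n).eval y ∂ν₂)
    {f : ℝ → ℝ} (hf : Continuous f) :
    ∫ y, h₁ y * f y ∂ν₁ = ∫ y, h₂ y * f y ∂ν₂ := by
  have i₁ := fun {f : ℝ → ℝ} (hf : Continuous f) =>
    integrable_mul_of_ae_mem_Icc hh₁ hν₁ hf
  have i₂ := fun {f : ℝ → ℝ} (hf : Continuous f) =>
    integrable_mul_of_ae_mem_Icc hh₂ hν₂ hf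
  let S : Submodule ℝ (Polynomial ℝ) :=
    { carrier := {p | ∫ y, h₁ y * p.eval y ∂ν₁ = ∫ y, h₂ y * p.eval y ∂ν₂}
      zero_mem' := by simp
      add_mem' := by
        intro p q hp hq
        simp only [mem_ofPred_eq, Polynomial.eval_add, mul_add] at *
        rw [integral_add (i₁ p.continuous) (i₁ q.continuous),
          integral_add (i₂ p.continuous) (i₂ q.continuous), hp, hq]
      smul_mem' := by
        intro c p hp
        simp only [mem_ofPred_eq, Polynomial.eval_smul, smul_eq_mul, mul_left_comm _ c] at *
        rw [integral_const_mul, integral_const_mul, hp] }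
  have hpoly : ∀ p : Polynomial ℝ, ∫ y, h₁ y * p.eval y ∂ν₁ = ∫ y, h₂ y * p.eval y ∂ν₂ :=
    fun p => mem_of_T_mem (S := S) hT p
  have bound : ∀ {ν : Measure ℝ} {h : ℝ → ℝ}, Integrable h ν → (∀ᵐ y ∂ν, y ∈ Icc (-1 : ℝ) 1) →
      ∀ ε > 0, ∀ p : Polynomial ℝ, (∀ x ∈ Icc (-1 : ℝ) 1, |p.eval x - f x| < ε) →
      |∫ y, h y * p.eval y ∂ν - ∫ y, h y * f y ∂ν| ≤ (∫ y, ‖h y‖ ∂ν) * ε := by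
    intro ν h hh hν ε _ p hp
    rw [← integral_sub (integrable_mul_of_ae_mem_Icc hh hν p.continuous)
      (integrable_mul_of_ae_mem_Icc hh hν hf), ← integral_mul_const,
      ← Real.norm_eq_abs]
    refine norm_integral_le_of_norm_le (hh.norm.mul_const ε) ?_
    filter_upwards [hν] with y hy
    rw [← mul_sub, norm_mul]
    exact mul_le_mul_of_nonneg_left (hp y hy).le (norm_nonneg _)
  set A := ∫ y, ‖h₁ y‖ ∂ν₁
  set B := ∫ y, ‖h₂ y‖ ∂ν₂
  have hA : 0 ≤ A := integral_nonneg fun _ => norm_nonneg _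
  have hB : 0 ≤ B := integral_nonneg fun _ => norm_nonneg _
  refine eq_of_forall_dist_le fun δ hδ => ?_
  obtain ⟨p, hp⟩ := exists_polynomial_near_of_continuousOn (-1) 1 f hf.continuousOn
    (δ / (A + B + 1)) (by positivity)
  have b₁ := bound hh₁ hν₁ _ (by positivity) p hp
  have b₂ := bound hh₂ hν₂ _ (by positivity) p hp
  rw [hpoly p] at b₁
  have hle : A * (δ / (A + B + 1)) + B * (δ / (A + B + 1)) ≤ δ := by
    rw [← add_mul, mul_div_assoc', div_le_iff₀ (by positivity)]
    nlinarith
  rw [Real.dist_eq, abs_le]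
  rw [abs_le] at b₁ b₂
  constructor <;> linarith [b₁.1, b₁.2, b₂.1, b₂.2]

theorem ae_measureT_mem_Icc : ∀ᵐ y ∂measureT, y ∈ Icc (-1 : ℝ) 1 :=
  ae_measureT_mem_Ioo.mono fun _ hy => Ioo_subset_Icc_self hy

/-- The moments of `α T₀ + β T₁ + γ T₂` with respect to the arcsine measure. -/
theorem integral_quadratic_mul_T (α β γ : ℝ) (n : ℕ) :
    ∫ y, (α + β * y + γ * (2 * y ^ 2 - 1)) * (Polynomial.Chebyshev.T ℝ n).eval y ∂measureT =
      if n = 0 then Real.pi * α else if n = 1 then Real.pi / 2 * β else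
        if n = 2 then Real.pi / 2 * γ else 0 := by
  have hi : ∀ m : ℕ, ∀ c : ℝ, Integrable (fun y => c * ((Polynomial.Chebyshev.T ℝ m).eval y *
      (Polynomial.Chebyshev.T ℝ n).eval y)) measureT := fun m c =>
    integrable_measureT (Continuous.continuousOn (by fun_prop))
  have e : ∀ y : ℝ, (α + β * y + γ * (2 * y ^ 2 - 1)) * (Polynomial.Chebyshev.T ℝ n).eval y =
      α * ((Polynomial.Chebyshev.T ℝ (0 : ℕ)).eval y * (Polynomial.Chebyshev.T ℝ n).eval y) +
      β * ((Polynomial.Chebyshev.T ℝ (1 : ℕ)).eval y * (Polynomial.Chebyshev.T ℝ n).eval y) +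
      γ * ((Polynomial.Chebyshev.T ℝ (2 : ℕ)).eval y * (Polynomial.Chebyshev.T ℝ n).eval y) := by
    intro y
    simp [Polynomial.Chebyshev.T_two]
    ring
  simp only [e]
  have hi₂ := (hi 0 α).add (hi 1 β)
  simp only [Pi.add_def] at hi₂
  rw [integral_add hi₂ (hi 2 γ), integral_add (hi 0 α) (hi 1 β),
    integral_const_mul, integral_const_mul, integral_const_mul]
  have hne := fun m k : ℕ => fun h : m ≠ k =>
    Polynomial.Chebyshev.integral_eval_T_real_mul_eval_T_real_measureT_of_ne h
  have hs := fun m : ℕ => fun h : m ≠ 0 =>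
    Polynomial.Chebyshev.integral_T_real_mul_self_measureT_of_ne_zero h
  have h00 := Polynomial.Chebyshev.integral_eval_T_real_mul_self_measureT_zero
  split_ifs with h0 h1 h2
  · subst h0
    rw [hne 1 0 (by omega), hne 2 0 (by omega)]
    rw [show ((0 : ℕ) : ℤ) = 0 from rfl, h00]; ring
  · subst h1
    rw [hne 0 1 (by omega), hne 2 1 (by omega), hs 1 (by omega)]; ring
  · subst h2
    rw [hne 0 2 (by omega), hne 1 2 (by omega), hs 2 (by omega)]; ring
  · rw [hne 0 n (by omega), hne 1 n (by omega), hne 2 n (by omega)]; ring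

/-- A density on `[-1, 1]` with vanishing Chebyshev moments of order at least `3` is a quadratic
polynomial times the arcsine density. -/
theorem exists_quadratic_of_moments_eq_zero {ν : Measure ℝ} {h : ℝ → ℝ} (hh : Integrable h ν)
    (hν : ∀ᵐ y ∂ν, y ∈ Icc (-1 : ℝ) 1)
    (hT : ∀ n : ℕ, 3 ≤ n → ∫ y, h y * (Polynomial.Chebyshev.T ℝ n).eval y ∂ν = 0) :
    ∃ a b c : ℝ, ∀ f : ℝ → ℝ, Continuous f →
      ∫ y, h y * f y ∂ν = ∫ y, (a + b * y + c * y ^ 2) * f y ∂measureT := by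
  set m : ℕ → ℝ := fun n => ∫ y, h y * (Polynomial.Chebyshev.T ℝ n).eval y ∂ν with hm
  have hpi := Real.pi_ne_zero
  refine ⟨m 0 / Real.pi - 2 * m 2 / Real.pi, 2 * m 1 / Real.pi, 2 * (2 * m 2 / Real.pi),
    fun f hf => ?_⟩
  refine integral_mul_eq_of_moments_eq hh
    (integrable_measureT (Continuous.continuousOn (by fun_prop))) hν ae_measureT_mem_Icc ?_ hf
  intro n
  have := integral_quadratic_mul_T (m 0 / Real.pi) (2 * m 1 / Real.pi) (2 * m 2 / Real.pi) n
  have e : ∀ y : ℝ, m 0 / Real.pi - 2 * m 2 / Real.pi + 2 * m 1 / Real.pi * y +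
      2 * (2 * m 2 / Real.pi) * y ^ 2 = m 0 / Real.pi + 2 * m 1 / Real.pi * y +
      2 * m 2 / Real.pi * (2 * y ^ 2 - 1) := fun y => by ring
  simp only [e, this]
  split_ifs with h0 h1 h2
  · subst h0; field_simp; rfl
  · subst h1; field_simp; rfl
  · subst h2; field_simp; rfl
  · exact hT n (by omega)

theorem integral_quadratic_mul_T_eq_zero (a b c : ℝ) {n : ℕ} (hn : 3 ≤ n) :
    ∫ y, (a + b * y + c * y ^ 2) * (Polynomial.Chebyshev.T ℝ n).eval y ∂measureT = 0 := by
  have := integral_quadratic_mul_T (a + c / 2) b (c / 2) n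
  rw [if_neg (by omega), if_neg (by omega), if_neg (by omega)] at this
  rw [← this]
  congr with y
  ring

/-! ### The fundamental solution -/

/-- The function `x ↦ (a - x) G(x, a)`, which solves `I(u)' = δ_a` on `(-1, 1)`. -/
def fundSol (a x : ℝ) : ℝ := (a - x) * rieszG x a

theorem greenG_eq (x z : ℝ) : greenG x z = 1 / 2 * (fundSol z x - fundSol (-z) x) := by
  simp only [greenG, fundSol]; ring

theorem fundSol_eq_zero {a x : ℝ} (hx : x ∉ Ioo (-1 : ℝ) 1) : fundSol a x = 0 := by
  rw [fundSol, rieszG, if_neg fun h => hx h.1, mul_zero]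

theorem one_sub_mul_add_sqrt_pos {a x : ℝ} (ha : a ∈ Ioo (-1 : ℝ) 1) (hx : x ∈ Icc (-1 : ℝ) 1) :
    0 < 1 - x * a + √((1 - x ^ 2) * (1 - a ^ 2)) := by
  have : 0 < 1 - x * a := by
    have : |x * a| < 1 := by
      rw [abs_mul]
      have h1 : |x| ≤ 1 := abs_le.2 hx
      have h2 : |a| < 1 := abs_lt.2 ha
      nlinarith [abs_nonneg x, abs_nonneg a]
    linarith [(abs_lt.1 this).2]
  positivity

theorem arsinh_sqrt_div_sq {a x : ℝ} (ha : a ∈ Ioo (-1 : ℝ) 1) (hx : x ∈ Icc (-1 : ℝ) 1)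
    (hxa : a - x ≠ 0) :
    Real.arsinh (√((1 - x ^ 2) * (1 - a ^ 2) / (x - a) ^ 2)) =
      Real.log (1 - x * a + √((1 - x ^ 2) * (1 - a ^ 2))) - Real.log (a - x) := by
  have hpos := one_sub_mul_add_sqrt_pos ha hx
  have hA : 0 ≤ (1 - x ^ 2) * (1 - a ^ 2) :=
    mul_nonneg (by nlinarith [hx.1, hx.2]) (by nlinarith [ha.1, ha.2])
  have hxa1 : 0 ≤ 1 - x * a := by nlinarith [hx.1, hx.2, ha.1, ha.2]
  have habs : 0 < |a - x| := abs_pos.2 hxa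
  have h1 : √((1 - x ^ 2) * (1 - a ^ 2) / (x - a) ^ 2) =
      √((1 - x ^ 2) * (1 - a ^ 2)) / |a - x| := by
    rw [Real.sqrt_div hA, Real.sqrt_sq_eq_abs, abs_sub_comm]
  have h2 : √(1 + (√((1 - x ^ 2) * (1 - a ^ 2)) / |a - x|) ^ 2) = (1 - x * a) / |a - x| := by
    rw [div_pow, Real.sq_sqrt hA, Real.sqrt_eq_iff_mul_self_eq (by positivity) (by positivity)]
    field_simp
    rw [sq_abs]
    ring
  rw [Real.arsinh, h1, h2, ← add_div, Real.log_div (by linarith) habs.ne', Real.log_abs, add_comm]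

/-- A formula for `fundSol` without singularities, valid on the closed interval. -/
theorem fundSol_eq {a x : ℝ} (ha : a ∈ Ioo (-1 : ℝ) 1) (hx : x ∈ Icc (-1 : ℝ) 1) :
    fundSol a x = Real.pi⁻¹ * ((a - x) * Real.log (1 - x * a + √((1 - x ^ 2) * (1 - a ^ 2))) -
      (a - x) * Real.log (a - x)) := by
  rcases eq_or_ne (a - x) 0 with h | hxa
  · simp [fundSol, h]
  · rw [← mul_sub, ← arsinh_sqrt_div_sq ha hx hxa]
    by_cases hx' : x ∈ Ioo (-1 : ℝ) 1
    · rw [fundSol, rieszG, if_pos ⟨hx', ha⟩]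
      ring
    · have : x ^ 2 = 1 := by
        rw [mem_Ioo, not_and_or, not_lt, not_lt] at hx'
        rcases hx' with h | h
        · rw [le_antisymm h hx.1]; norm_num
        · rw [le_antisymm hx.2 h]; norm_num
      rw [fundSol_eq_zero hx', this]
      simp

theorem continuous_fundSol {a : ℝ} (ha : a ∈ Ioo (-1 : ℝ) 1) : Continuous (fundSol a) := by
  -- outside `[-1, 1]` the function is constant, so it factors through the retraction onto `[-1, 1]`
  have e : fundSol a = fun x => fundSol a (projIcc (-1 : ℝ) 1 (by norm_num) x) := by
    ext x
    rcases le_total x (-1) with h | h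
    · rw [projIcc_of_le_left _ h, fundSol_eq_zero fun hx => by linarith [hx.1],
        fundSol_eq_zero (by simp)]
    rcases le_total 1 x with h' | h'
    · rw [projIcc_of_right_le _ h', fundSol_eq_zero fun hx => by linarith [hx.2],
        fundSol_eq_zero (by simp)]
    rw [projIcc_of_mem _ ⟨h, h'⟩]
  rw [e]
  have hc : Continuous fun x : Icc (-1 : ℝ) 1 => fundSol a x := by
    have e2 : (fun x : Icc (-1 : ℝ) 1 => fundSol a x) = fun x : Icc (-1 : ℝ) 1 => Real.pi⁻¹ *
        ((a - x) * Real.log (1 - x * a + √((1 - x ^ 2) * (1 - a ^ 2))) -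
          (a - x) * Real.log (a - x)) := funext fun x => fundSol_eq ha x.2
    rw [e2]
    refine continuous_const.mul (Continuous.sub (Continuous.mul (by fun_prop)
      (Continuous.log (by fun_prop) fun x => (one_sub_mul_add_sqrt_pos ha x.2).ne')) ?_)
    exact Real.continuous_mul_log.comp (by fun_prop : Continuous fun x : Icc (-1 : ℝ) 1 => a - x)
  exact hc.comp continuous_projIcc

theorem integrable_fundSol {a : ℝ} (ha : a ∈ Ioo (-1 : ℝ) 1) : Integrable (fundSol a) := by
  refine (continuous_fundSol ha).integrable_of_hasCompactSupport
    (HasCompactSupport.of_support_subset_isCompact isCompact_Icc (K := Icc (-1) 1) fun x hx => ?_)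
  by_contra h
  exact hx (fundSol_eq_zero fun h' => h (Ioo_subset_Icc_self h'))

/-- Boundary behaviour of `(a - x) G(x, a)` at `e = ±1`. The limit is even in `a`, so that it
cancels in `g(x, z)`. -/
theorem tendsto_fundSol_div_sqrt {a e : ℝ} (ha : a ∈ Ioo (-1 : ℝ) 1) (he : e = 1 ∨ e = -1)
    {l : Filter ℝ} (hl : l ≤ 𝓝 e) (hl' : ∀ᶠ x in l, x ∈ Ioo (-1 : ℝ) 1) :
    Tendsto (fun x => fundSol a x / √(1 - x ^ 2)) l (𝓝 (-e * Real.pi⁻¹ * √(1 - a ^ 2))) := by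
  have hea : |e - a| = 1 - e * a := by
    rcases he with rfl | rfl
    · rw [abs_of_pos (by linarith [ha.2])]; ring
    · rw [abs_of_neg (by linarith [ha.1])]; ring
  have he2 : e ^ 2 = 1 := by rcases he with rfl | rfl <;> norm_num
  have hea' : 0 < |e - a| := by
    rw [hea]; rcases he with rfl | rfl <;> linarith [ha.1, ha.2]
  -- `arsinh s = s * q s` with `q` continuous at `0` and `q 0 = 1`
  set q := dslope Real.arsinh 0 with hq
  have hqc : ContinuousAt q 0 :=
    continuousAt_dslope_same.2 Real.differentiable_arsinh.differentiableAt
  have hq0 : q 0 = 1 := by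
    rw [hq, dslope_same, (Real.hasDerivAt_arsinh 0).deriv]; simp
  have hqs : ∀ s, Real.arsinh s = s * q s := by
    intro s
    have := sub_smul_dslope Real.arsinh 0 s
    simpa using this.symm
  have hF : Tendsto (fun x => Real.pi⁻¹ * ((a - x) * (√(1 - a ^ 2) / |x - a|) *
      q (√(1 - x ^ 2) * (√(1 - a ^ 2) / |x - a|)))) (𝓝 e)
      (𝓝 (Real.pi⁻¹ * ((a - e) * (√(1 - a ^ 2) / |e - a|) * 1))) := by
    have h1 : ContinuousAt (fun x => √(1 - a ^ 2) / |x - a|) e :=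
      continuousAt_const.div (by fun_prop) hea'.ne'
    have h2 : Tendsto (fun x => √(1 - x ^ 2) * (√(1 - a ^ 2) / |x - a|)) (𝓝 e) (𝓝 0) := by
      have h3 : ContinuousAt (fun x => √(1 - x ^ 2) * (√(1 - a ^ 2) / |x - a|)) e :=
        ContinuousAt.mul (by fun_prop) h1
      have := h3.tendsto
      rwa [he2, sub_self, Real.sqrt_zero, zero_mul] at this
    have h4 : Tendsto q (𝓝 0) (𝓝 1) := by rw [← hq0]; exact hqc
    have h5 : ContinuousAt (fun x => (a - x) * (√(1 - a ^ 2) / |x - a|)) e :=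
      ContinuousAt.mul (by fun_prop) h1
    exact (h5.tendsto.mul (h4.comp h2)).const_mul _
  have hlim : Real.pi⁻¹ * ((a - e) * (√(1 - a ^ 2) / |e - a|) * 1) =
      -e * Real.pi⁻¹ * √(1 - a ^ 2) := by
    rw [hea] at hea' ⊢
    have : a - e = -e * (1 - e * a) := by linear_combination (-a) * he2
    rw [this]
    field_simp
  rw [← hlim]
  refine (hF.mono_left hl).congr' ?_
  filter_upwards [hl'] with x hx
  have hs : 0 < √(1 - x ^ 2) := Real.sqrt_pos.2 (by nlinarith [hx.1, hx.2])
  have hs2 : √((1 - x ^ 2) * (1 - a ^ 2) / (x - a) ^ 2) =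
      √(1 - x ^ 2) * (√(1 - a ^ 2) / |x - a|) := by
    rw [mul_div_assoc, Real.sqrt_mul (by nlinarith [hx.1, hx.2]),
      Real.sqrt_div (by nlinarith [ha.1, ha.2]), Real.sqrt_sq_eq_abs]
  rw [fundSol, rieszG, if_pos ⟨hx, ha⟩, hs2, hqs]
  field_simp

theorem neg_mem_Ioo {a : ℝ} (ha : a ∈ Ioo (-1 : ℝ) 1) : -a ∈ Ioo (-1 : ℝ) 1 :=
  ⟨by linarith [ha.2], by linarith [ha.1]⟩

theorem isLittleO_greenG {z e : ℝ} (hz : z ∈ Ioo (-1 : ℝ) 1) (he : e = 1 ∨ e = -1)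
    {l : Filter ℝ} (hl : l ≤ 𝓝 e) (hl' : ∀ᶠ x in l, x ∈ Ioo (-1 : ℝ) 1) :
    (fun x => greenG x z) =o[l] fun x => √(1 - x ^ 2) := by
  rw [isLittleO_iff_tendsto']
  · have h := ((tendsto_fundSol_div_sqrt hz he hl hl').sub
      (tendsto_fundSol_div_sqrt (neg_mem_Ioo hz) he hl hl')).const_mul (1 / 2)
    rw [neg_sq, sub_self, mul_zero] at h
    refine h.congr fun x => ?_
    rw [greenG_eq]
    ring
  · filter_upwards [hl'] with x hx h
    have : 0 < √(1 - x ^ 2) := Real.sqrt_pos.2 (by nlinarith [hx.1, hx.2])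
    exact absurd h this.ne'

/-! ### The logarithmic potential of the fundamental solution -/

/-- For `n ≥ 3`, both sides have the same expression in terms of `arccos a`. -/
theorem integral_fundSol_mul_T {a : ℝ} (ha : a ∈ Ioo (-1 : ℝ) 1) {n : ℕ} (hn : 3 ≤ n) :
    ∫ x, fundSol a x * (Polynomial.Chebyshev.T ℝ n).eval x =
      n * ∫ y, (max (y - a) 0) ^ 2 / 2 * (Polynomial.Chebyshev.T ℝ n).eval y ∂measureT := by
  obtain ⟨φ, hφ, rfl⟩ : ∃ φ ∈ Ioo 0 Real.pi, a = Real.cos φ :=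
    ⟨Real.arccos a, ⟨Real.arccos_pos.2 ha.2, lt_of_le_of_ne (Real.arccos_le_pi a) fun h => by
      linarith [Real.arccos_eq_pi.1 h, ha.1]⟩, (Real.cos_arccos ha.1.le ha.2.le).symm⟩
  have hl : ∫ x, fundSol (Real.cos φ) x * (Polynomial.Chebyshev.T ℝ n).eval x =
      ∫ t in (0 : ℝ)..Real.pi, (Real.cos φ - Real.cos t) * rieszG (Real.cos t) (Real.cos φ) *
        Real.sin t * Real.cos (n * t) := by
    rw [← setIntegral_Ioo_eq_integral fun y hy => by rw [fundSol_eq_zero hy, zero_mul],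
      ← integral_mul_sqrt_measureT, integral_measureT_eq_integral_cos]
    refine intervalIntegral.integral_congr fun t ht => ?_
    rw [uIcc_of_le Real.pi_pos.le] at ht
    rw [← Real.sin_sq, Real.sqrt_sq (Real.sin_nonneg_of_mem_Icc ht),
      Polynomial.Chebyshev.T_real_cos, fundSol, Int.cast_natCast]
    ring
  have hr : ∫ y, (max (y - Real.cos φ) 0) ^ 2 / 2 * (Polynomial.Chebyshev.T ℝ n).eval y ∂measureT =
      ∫ t in (0 : ℝ)..φ, (Real.cos t - Real.cos φ) ^ 2 / 2 * Real.cos (n * t) := by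
    rw [integral_measureT_eq_integral_cos, ← intervalIntegral.integral_add_adjacent_intervals
      (b := φ) (Continuous.intervalIntegrable (by fun_prop) _ _)
      (Continuous.intervalIntegrable (by fun_prop) _ _)]
    have h1 : ∫ t in φ..Real.pi, (max (Real.cos t - Real.cos φ) 0) ^ 2 / 2 *
        (Polynomial.Chebyshev.T ℝ n).eval (Real.cos t) = 0 := by
      refine intervalIntegral.integral_zero_ae (.of_forall fun t ht => ?_)
      rw [uIoc_of_le hφ.2.le] at ht
      rw [max_eq_right]
      · simp
      · linarith [Real.cos_le_cos_of_nonneg_of_le_pi hφ.1.le ht.2 ht.1.le]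
    rw [h1, add_zero]
    refine intervalIntegral.integral_congr fun t ht => ?_
    rw [uIcc_of_le hφ.1.le] at ht
    rw [max_eq_left, Polynomial.Chebyshev.T_real_cos, Int.cast_natCast]
    linarith [Real.cos_le_cos_of_nonneg_of_le_pi ht.1 hφ.2.le ht.2]
  rw [hl, hr, integral_sub_mul_rieszG_cos_mul hφ hn, integral_sq_sub_cos_mul φ hn]

theorem integral_quadratic_mul_deriv₃ {φ : ℝ → ℝ} (hφ : ContDiff ℝ 3 φ) (a b c s t : ℝ) :
    ∫ y in s..t, (a + b * y + c * y ^ 2) * deriv (deriv (deriv φ)) y =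
      ((a + b * t + c * t ^ 2) * deriv (deriv φ) t - (b + 2 * c * t) * deriv φ t + 2 * c * φ t) -
      ((a + b * s + c * s ^ 2) * deriv (deriv φ) s - (b + 2 * c * s) * deriv φ s + 2 * c * φ s) := by
  have h1 : ContDiff ℝ 2 (deriv φ) := (contDiff_succ_iff_deriv (n := 2).1 hφ).2.2
  have h2 : ContDiff ℝ 1 (deriv (deriv φ)) := (contDiff_succ_iff_deriv (n := 1).1 h1).2.2
  have d0 := fun y => (hφ.differentiable (by norm_num) y).hasDerivAt
  have d1 := fun y => (h1.differentiable (by norm_num) y).hasDerivAt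
  have d2 := fun y => (h2.differentiable (by norm_num) y).hasDerivAt
  have hc := h2.continuous_deriv le_rfl
  refine intervalIntegral.integral_eq_sub_of_hasDerivAt (f := fun y =>
    (a + b * y + c * y ^ 2) * deriv (deriv φ) y - (b + 2 * c * y) * deriv φ y + 2 * c * φ y)
    (fun y _ => ?_) (Continuous.intervalIntegrable (by fun_prop) _ _)
  have p1 : HasDerivAt (fun y : ℝ => a + b * y + c * y ^ 2) (b + 2 * c * y) y := by
    refine ((((hasDerivAt_id y).const_mul b).const_add a).add
      (((hasDerivAt_id y).pow 2).const_mul c)).congr_deriv ?_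
    simp only [id]; push_cast; ring
  have p2 : HasDerivAt (fun y : ℝ => b + 2 * c * y) (2 * c) y := by
    simpa using ((hasDerivAt_id y).const_mul (2 * c)).const_add b
  refine (((p1.mul (d2 y)).sub (p2.mul (d1 y))).add ((d0 y).const_mul (2 * c))).congr_deriv ?_
  ring

theorem setIntegral_quadratic_mul_lineDeriv₃ (a b c : ℝ) (φ : 𝓓(symmInterval, ℝ)) :
    ∫ y in Ioo (-1 : ℝ) 1, (a + b * y + c * y ^ 2) *
      (∂_{(1 : ℝ)} (∂_{(1 : ℝ)} (∂_{(1 : ℝ)} φ)) : 𝓓(symmInterval, ℝ)) y = 0 := by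
  have hz : ∀ (ψ : 𝓓(symmInterval, ℝ)), ψ 1 = 0 ∧ ψ (-1) = 0 := fun ψ =>
    ⟨test_eq_zero (by simp), test_eq_zero (by simp)⟩
  have h0 := hz φ
  have h1 := hz (∂_{(1 : ℝ)} φ)
  have h2 := hz (∂_{(1 : ℝ)} (∂_{(1 : ℝ)} φ))
  simp only [coe_lineDeriv_test] at h1 h2
  rw [← integral_Ioc_eq_integral_Ioo, ← intervalIntegral.integral_of_le (by norm_num)]
  simp only [coe_lineDeriv_test]
  rw [integral_quadratic_mul_deriv₃ (contDiff_infty.1 φ.contDiff 3), h0.1, h0.2, h1.1, h1.2, h2.1,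
    h2.2]
  ring

/-- The third distributional derivative of `(y - a)₊² / 2` is `δ_a`. -/
theorem setIntegral_max_sq_mul_lineDeriv₃ {a : ℝ} (ha : a ∈ Ioo (-1 : ℝ) 1)
    (φ : 𝓓(symmInterval, ℝ)) :
    ∫ y in Ioo (-1 : ℝ) 1, (max (y - a) 0) ^ 2 / 2 *
      (∂_{(1 : ℝ)} (∂_{(1 : ℝ)} (∂_{(1 : ℝ)} φ)) : 𝓓(symmInterval, ℝ)) y = -φ a := by
  have hz : ∀ (ψ : 𝓓(symmInterval, ℝ)), ψ 1 = 0 := fun ψ => test_eq_zero (by simp)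
  have h0 := hz φ
  have h1 := hz (∂_{(1 : ℝ)} φ)
  have h2 := hz (∂_{(1 : ℝ)} (∂_{(1 : ℝ)} φ))
  have hc := (∂_{(1 : ℝ)} (∂_{(1 : ℝ)} (∂_{(1 : ℝ)} φ)) : 𝓓(symmInterval, ℝ)).continuous
  rw [← integral_Ioc_eq_integral_Ioo, ← intervalIntegral.integral_of_le (by norm_num),
    ← intervalIntegral.integral_add_adjacent_intervals (b := a)
      (Continuous.intervalIntegrable (by fun_prop) _ _)
      (Continuous.intervalIntegrable (by fun_prop) _ _)]
  have e1 : ∫ y in (-1 : ℝ)..a, (max (y - a) 0) ^ 2 / 2 *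
      (∂_{(1 : ℝ)} (∂_{(1 : ℝ)} (∂_{(1 : ℝ)} φ)) : 𝓓(symmInterval, ℝ)) y = 0 := by
    refine intervalIntegral.integral_zero_ae (.of_forall fun t ht => ?_)
    rw [uIoc_of_le ha.1.le] at ht
    rw [max_eq_right (by linarith [ht.2])]
    simp
  have e2 : ∫ y in a..1, (max (y - a) 0) ^ 2 / 2 *
      (∂_{(1 : ℝ)} (∂_{(1 : ℝ)} (∂_{(1 : ℝ)} φ)) : 𝓓(symmInterval, ℝ)) y =
      ∫ y in a..1, (a ^ 2 / 2 + (-a) * y + 1 / 2 * y ^ 2) * deriv (deriv (deriv φ)) y := by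
    refine intervalIntegral.integral_congr fun t ht => ?_
    rw [uIcc_of_le ha.2.le] at ht
    simp only [coe_lineDeriv_test]
    rw [max_eq_left (by linarith [ht.1])]
    ring
  simp only [coe_lineDeriv_test] at h1 h2
  rw [e1, e2, integral_quadratic_mul_deriv₃ (contDiff_infty.1 φ.contDiff 3), h0, h1, h2]
  ring

/-- The logarithmic potential of `fundSol a` is `-π (y - a)₊² / 2` up to a quadratic polynomial,
since both have the same Chebyshev moments of order at least `3`; hence its third derivative is
`-π δ_a`. -/
theorem integral_fundSol_mul_integral_log {a : ℝ} (ha : a ∈ Ioo (-1 : ℝ) 1)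
    (φ : 𝓓(symmInterval, ℝ)) :
    ∫ x, fundSol a x * ∫ y, Real.log (x - y) *
      (∂_{(1 : ℝ)} (∂_{(1 : ℝ)} (∂_{(1 : ℝ)} φ)) : 𝓓(symmInterval, ℝ)) y = Real.pi * φ a := by
  have hk := integrable_fundSol ha
  have hk0 : ∀ x ∉ Ioo (-1 : ℝ) 1, fundSol a x = 0 := fun x hx => fundSol_eq_zero hx
  have hL := integrable_logPotential hk hk0
  have hp : ∀ f : ℝ → ℝ, Continuous f →
      Integrable (fun y => (max (y - a) 0) ^ 2 / 2 * f y) measureT := fun f hf =>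
    integrable_measureT (Continuous.continuousOn (by fun_prop))
  have hLf : ∀ f : ℝ → ℝ, Continuous f →
      Integrable (fun y => logPotential (fundSol a) y * f y) measureT := fun f hf =>
    integrable_mul_of_ae_mem_Icc hL ae_measureT_mem_Icc hf
  have hadd : ∀ f : ℝ → ℝ, Continuous f →
      ∫ y, (logPotential (fundSol a) y + Real.pi * ((max (y - a) 0) ^ 2 / 2)) * f y ∂measureT =
        ∫ y, logPotential (fundSol a) y * f y ∂measureT +
          Real.pi * ∫ y, (max (y - a) 0) ^ 2 / 2 * f y ∂measureT := by
    intro f hf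
    rw [← integral_const_mul, ← integral_add (hLf f hf) ((hp f hf).const_mul _)]
    congr with y
    ring
  obtain ⟨α, β, γ, hq⟩ := exists_quadratic_of_moments_eq_zero
    (h := fun y => logPotential (fundSol a) y + Real.pi * ((max (y - a) 0) ^ 2 / 2))
    (hL.add (by simpa using (hp (fun _ => 1) continuous_const).const_mul Real.pi))
    ae_measureT_mem_Icc (fun n hn => by
      rw [hadd _ (Polynomial.continuous _),
        ← integral_mul_integral_log_measureT hk hk0 (Polynomial.continuous _)]
      have e : ∀ x, fundSol a x * ∫ y, Real.log (x - y) *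
          (Polynomial.Chebyshev.T ℝ n).eval y ∂measureT =
          -Real.pi / n * (fundSol a x * (Polynomial.Chebyshev.T ℝ n).eval x) := by
        intro x
        by_cases hx : x ∈ Ioo (-1 : ℝ) 1
        · rw [integral_log_sub_mul_T (Ioo_subset_Icc_self hx) (by omega)]; ring
        · simp [hk0 x hx]
      simp only [e]
      rw [integral_const_mul, integral_fundSol_mul_T ha hn]
      have : (n : ℝ) ≠ 0 := by positivity
      field_simp
      ring)
  set f := (∂_{(1 : ℝ)} (∂_{(1 : ℝ)} (∂_{(1 : ℝ)} φ)) : 𝓓(symmInterval, ℝ)) with hf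
  have hfc := f.continuous
  have h := hq (fun y => f y * √(1 - y ^ 2)) (by fun_prop)
  rw [hadd _ (by fun_prop)] at h
  simp only [← mul_assoc] at h
  rw [integral_mul_sqrt_measureT (fun y => (max (y - a) 0) ^ 2 / 2 * f y),
    integral_mul_sqrt_measureT (fun y => (α + β * y + γ * y ^ 2) * f y),
    setIntegral_max_sq_mul_lineDeriv₃ ha, setIntegral_quadratic_mul_lineDeriv₃] at h
  rw [integral_mul_integral_log hk hk0 hfc fun y hy => test_eq_zero hy]
  simp only [← mul_assoc]
  linarith

theorem continuous_greenG {z : ℝ} (hz : z ∈ Ioo (-1 : ℝ) 1) : Continuous fun x => greenG x z := by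
  simp only [greenG_eq]
  exact continuous_const.mul ((continuous_fundSol hz).sub (continuous_fundSol (neg_mem_Ioo hz)))

theorem isGreenSolution_greenG {z : ℝ} (hz : z ∈ Ioo (-1 : ℝ) 1) :
    IsGreenSolution z fun x => greenG x z where
  integrable := by
    simp only [greenG_eq]
    exact ((integrable_fundSol hz).sub (integrable_fundSol (neg_mem_Ioo hz))).const_mul _
  equation := by
    have hi : Integrable fun x => greenG x z := by
      simp only [greenG_eq]
      exact ((integrable_fundSol hz).sub (integrable_fundSol (neg_mem_Ioo hz))).const_mul _
    refine (equation_iff hi z).2 fun φ => ?_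
    have hint : ∀ {a : ℝ}, a ∈ Ioo (-1 : ℝ) 1 → Integrable fun x => fundSol a x *
        ∫ y, Real.log (x - y) *
          (∂_{(1 : ℝ)} (∂_{(1 : ℝ)} (∂_{(1 : ℝ)} φ)) : 𝓓(symmInterval, ℝ)) y := fun {a} ha =>
      integrable_mul_integral_log (integrable_fundSol ha) (fun _ hx => fundSol_eq_zero hx)
        (TestFunction.continuous _) fun _ hy => test_eq_zero hy
    have h := integral_sub (hint hz) (hint (neg_mem_Ioo hz))
    rw [integral_fundSol_mul_integral_log hz, integral_fundSol_mul_integral_log (neg_mem_Ioo hz)]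
      at h
    simp only [greenG_eq, mul_assoc, sub_mul]
    rw [integral_const_mul, h]
    ring
  eq_zero := fun x hx => by simp [greenG_eq, fundSol_eq_zero hx]
  isLittleO_left := isLittleO_greenG hz (.inr rfl) nhdsWithin_le_nhds
    (Ioo_mem_nhdsGT (by norm_num))
  isLittleO_right := isLittleO_greenG hz (.inl rfl) nhdsWithin_le_nhds
    (Ioo_mem_nhdsLT (by norm_num))

/-! ### Uniqueness -/

theorem restrict_Ioo_le_measureT : (volume : Measure ℝ).restrict (Ioo (-1) 1) ≤ measureT := by
  refine Measure.le_iff.2 fun s hs => ?_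
  rw [Measure.restrict_apply hs, measureT, Measure.restrict_apply hs,
    withDensity_apply _ (hs.inter measurableSet_Ioc), ← setLIntegral_one]
  refine (setLIntegral_mono' (hs.inter measurableSet_Ioo) fun x hx => ?_).trans
    (lintegral_mono_set (inter_subset_inter_right s Ioo_subset_Ioc_self))
  rw [ENNReal.one_le_coe_iff, ← NNReal.coe_le_coe]
  change (1 : ℝ) ≤ √(1 - x ^ 2)⁻¹
  have h1 : 0 < 1 - x ^ 2 := by nlinarith [hx.2.1, hx.2.2]
  exact Real.one_le_sqrt.2 ((one_le_inv₀ h1).2 (by nlinarith [sq_nonneg x]))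

/-- Two functions integrable on `(-1, 1)` that agree as distributions there agree a.e. -/
theorem ae_eq_of_integral_test_eq {f g : ℝ → ℝ} (hf : IntegrableOn f (Ioo (-1) 1))
    (hg : IntegrableOn g (Ioo (-1) 1))
    (h : ∀ φ : 𝓓(symmInterval, ℝ), ∫ y in Ioo (-1 : ℝ) 1, f y * φ y =
      ∫ y in Ioo (-1 : ℝ) 1, g y * φ y) :
    ∀ᵐ y, y ∈ Ioo (-1 : ℝ) 1 → f y = g y := by
  have key : ∀ᵐ y, y ∈ Ioo (-1 : ℝ) 1 → (f - g) y = 0 := by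
    refine isOpen_Ioo.ae_eq_zero_of_integral_contDiff_smul_eq_zero
      (hf.sub hg).locallyIntegrableOn fun φ hφ hφc hφs => ?_
    have h1 := h ⟨φ, hφ, hφc, hφs⟩
    change ∫ y in Ioo (-1 : ℝ) 1, f y * φ y = ∫ y in Ioo (-1 : ℝ) 1, g y * φ y at h1
    obtain ⟨B, hB⟩ := hφc.exists_bound_of_continuous hφ.continuous
    have hi : ∀ {f : ℝ → ℝ}, IntegrableOn f (Ioo (-1) 1) →
        IntegrableOn (fun y => f y * φ y) (Ioo (-1) 1) := fun hf =>
      hf.mul_bdd (c := B) hφ.continuous.aestronglyMeasurable (.of_forall hB)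
    rw [← setIntegral_Ioo_eq_integral fun y hy => by
      rw [image_eq_zero_of_notMem_tsupport fun h => hy (hφs h), zero_smul]]
    rw [← sub_eq_zero, ← integral_sub (hi hf) (hi hg)] at h1
    rw [← h1]
    congr with y
    simp only [Pi.sub_apply, smul_eq_mul]
    ring
  filter_upwards [key] with y hy hyI
  exact sub_eq_zero.1 (hy hyI)

theorem logPotential_ae_eq_quadratic {d : ℝ → ℝ} (hd : Integrable d)
    (hd0 : ∀ x ∉ Ioo (-1 : ℝ) 1, d x = 0)
    (hlog : ∀ φ : 𝓓(symmInterval, ℝ), ∫ x, d x * ∫ y, Real.log (x - y) *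
      (∂_{(1 : ℝ)} (∂_{(1 : ℝ)} (∂_{(1 : ℝ)} φ)) : 𝓓(symmInterval, ℝ)) y = 0) :
    ∃ a b c : ℝ, ∀ᵐ y ∂measureT, logPotential d y = a + b * y + c * y ^ 2 := by
  have hL : IntegrableOn (logPotential d) (Ioo (-1) 1) :=
    (integrable_logPotential hd hd0).mono_measure restrict_Ioo_le_measureT
  have hLφ : ∀ φ : 𝓓(symmInterval, ℝ), IntegrableOn (fun y => logPotential d y * φ y)
      (Ioo (-1) 1) := fun φ => by
    obtain ⟨B, hB⟩ := φ.hasCompactSupport.exists_bound_of_continuous φ.continuous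
    exact hL.mul_bdd (c := B) φ.continuous.aestronglyMeasurable (.of_forall hB)
  let Λ : 𝓓(symmInterval, ℝ) →ₗ[ℝ] ℝ :=
    { toFun := fun φ => ∫ y in Ioo (-1 : ℝ) 1, logPotential d y * φ y
      map_add' := fun φ ψ => by
        simp only [_root_.add_apply, mul_add]
        exact integral_add (hLφ φ) (hLφ ψ)
      map_smul' := fun c φ => by
        simp only [_root_.smul_apply, smul_eq_mul, mul_left_comm _ c, RingHom.id_apply]
        exact integral_const_mul _ _ }
  obtain ⟨a, b, c, h⟩ := exists_eq_integral_quadratic Λ fun φ => by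
    have := hlog φ
    rw [integral_mul_integral_log hd hd0 (TestFunction.continuous _)
      fun y hy => test_eq_zero hy] at this
    simp only [← mul_assoc] at this
    rwa [integral_mul_sqrt_measureT] at this
  refine ⟨a, b, c, ?_⟩
  have hq : IntegrableOn (fun y : ℝ => a + b * y + c * y ^ 2) (Ioo (-1) 1) :=
    (Continuous.integrableOn_Icc (by fun_prop)).mono_set Ioo_subset_Icc_self
  have hae := ae_eq_of_integral_test_eq hL hq fun φ => by
    rw [setIntegral_Ioo_eq_integral (f := fun y => (a + b * y + c * y ^ 2) * φ y)
      fun y hy => by rw [test_eq_zero hy, mul_zero]]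
    exact h φ
  filter_upwards [measureT_absolutelyContinuous.ae_le hae, ae_measureT_mem_Ioo] with y h1 h2
  exact h1 h2

theorem exists_ae_eq_quadratic_mul_arcsine {d : ℝ → ℝ} (hd : Integrable d)
    (hd0 : ∀ x ∉ Ioo (-1 : ℝ) 1, d x = 0)
    (hlog : ∀ φ : 𝓓(symmInterval, ℝ), ∫ x, d x * ∫ y, Real.log (x - y) *
      (∂_{(1 : ℝ)} (∂_{(1 : ℝ)} (∂_{(1 : ℝ)} φ)) : 𝓓(symmInterval, ℝ)) y = 0) :
    ∃ a b c : ℝ, ∀ᵐ x, x ∈ Ioo (-1 : ℝ) 1 →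
      d x = (a + b * x + c * x ^ 2) * √(1 - x ^ 2)⁻¹ := by
  obtain ⟨a₀, b₀, c₀, hL⟩ := logPotential_ae_eq_quadratic hd hd0 hlog
  have hmom : ∀ n : ℕ, 3 ≤ n →
      ∫ x in Ioo (-1 : ℝ) 1, d x * (Polynomial.Chebyshev.T ℝ n).eval x = 0 := by
    intro n hn
    rw [setIntegral_Ioo_eq_integral fun x hx => by rw [hd0 x hx, zero_mul]]
    have h1 := integral_mul_integral_log_measureT hd hd0
      (Polynomial.Chebyshev.T ℝ n).continuous
    have h2 : ∫ y, logPotential d y * (Polynomial.Chebyshev.T ℝ n).eval y ∂measureT = 0 := by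
      rw [← integral_quadratic_mul_T_eq_zero a₀ b₀ c₀ hn]
      refine integral_congr_ae ?_
      filter_upwards [hL] with y hy
      rw [hy]
    have e : ∀ x, d x * ∫ y, Real.log (x - y) *
        (Polynomial.Chebyshev.T ℝ n).eval y ∂measureT =
        -Real.pi / n * (d x * (Polynomial.Chebyshev.T ℝ n).eval x) := by
      intro x
      by_cases hx : x ∈ Ioo (-1 : ℝ) 1
      · rw [integral_log_sub_mul_T (Ioo_subset_Icc_self hx) (by omega)]; ring
      · simp [hd0 x hx]
    simp only [e] at h1
    rw [integral_const_mul, h2] at h1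
    have : -Real.pi / (n : ℝ) ≠ 0 :=
      div_ne_zero (neg_ne_zero.2 Real.pi_ne_zero) (by positivity)
    exact (mul_eq_zero.1 h1).resolve_left this
  obtain ⟨a, b, c, h⟩ := exists_quadratic_of_moments_eq_zero (ν := volume.restrict (Ioo (-1) 1))
    hd.integrableOn ((ae_restrict_mem measurableSet_Ioo).mono fun _ hy => Ioo_subset_Icc_self hy)
    hmom
  refine ⟨a, b, c, ae_eq_of_integral_test_eq hd.integrableOn ?_ fun φ => ?_⟩
  · have := (Polynomial.Chebyshev.intervalIntegrable_sqrt_one_sub_sq_inv.continuousOn_mul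
      (g := fun x => a + b * x + c * x ^ 2) (Continuous.continuousOn (by fun_prop)))
    exact ((intervalIntegrable_iff_integrableOn_Ioc_of_le (by norm_num)).1 this).mono_set
      Ioo_subset_Ioc_self
  · rw [h φ φ.continuous, integral_measureT, intervalIntegral.integral_of_le (by norm_num),
      integral_Ioc_eq_integral_Ioo]
    congr with y
    ring

/-- An a.e. identity still holds along some filter converging to the boundary point, which is enough
to transfer the boundary condition from `d` to `P`. -/
theorem exists_filter_isLittleO_of_ae {d P : ℝ → ℝ} {e : ℝ} (he : e ∈ Icc (-1 : ℝ) 1)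
    (hP : ∀ᵐ x, x ∈ Ioo (-1 : ℝ) 1 → d x = P x * √(1 - x ^ 2)⁻¹)
    (hd : d =o[𝓝[Ioo (-1) 1] e] fun x => √(1 - x ^ 2)) :
    ∃ l : Filter ℝ, l.NeBot ∧ l ≤ 𝓝 e ∧ (∀ᶠ x in l, x ∈ Ioo (-1 : ℝ) 1) ∧
      P =o[l] fun x => 1 - x ^ 2 := by
  set s := {x | x ∈ Ioo (-1 : ℝ) 1 → d x = P x * √(1 - x ^ 2)⁻¹}
  have hs : Dense s := Measure.dense_of_ae hP
  have hcl : e ∈ closure (Ioo (-1 : ℝ) 1 ∩ s) := by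
    have := closure_mono (hs.open_subset_closure_inter (isOpen_Ioo (a := (-1 : ℝ)) (b := 1)))
    rw [closure_Ioo (by norm_num), closure_closure] at this
    exact this he
  have hmem : ∀ᶠ x in 𝓝[Ioo (-1 : ℝ) 1 ∩ s] e, x ∈ Ioo (-1 : ℝ) 1 ∩ s := self_mem_nhdsWithin
  refine ⟨𝓝[Ioo (-1 : ℝ) 1 ∩ s] e, mem_closure_iff_nhdsWithin_neBot.1 hcl, nhdsWithin_le_nhds,
    hmem.mono fun x hx => hx.1, ?_⟩
  have h := (hd.mono (nhdsWithin_mono e inter_subset_left)).mul_isBigO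
    (isBigO_refl (fun x => √(1 - x ^ 2)) (𝓝[Ioo (-1 : ℝ) 1 ∩ s] e))
  refine h.congr' ?_ ?_
  · filter_upwards [hmem] with x hx
    have : 0 < √(1 - x ^ 2) := Real.sqrt_pos.2 (by nlinarith [hx.1.1, hx.1.2])
    rw [hx.2 hx.1, Real.sqrt_inv, inv_mul_cancel_right₀ this.ne']
  · filter_upwards [hmem] with x hx
    exact Real.mul_self_sqrt (by nlinarith [hx.1.1, hx.1.2])

theorem quadratic_eq_zero_of_isLittleO {a b c e : ℝ} (he : e ^ 2 = 1) {l : Filter ℝ} [l.NeBot]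
    (hl : l ≤ 𝓝 e) (h : (fun x => a + b * x + c * x ^ 2) =o[l] fun x => 1 - x ^ 2) :
    a + b * e + c = 0 := by
  have h1 : Tendsto (fun x : ℝ => 1 - x ^ 2) l (𝓝 0) := by
    have : Continuous fun x : ℝ => 1 - x ^ 2 := by fun_prop
    have := (this.tendsto e).mono_left hl
    rwa [he, sub_self] at this
  have h2 : Tendsto (fun x : ℝ => a + b * x + c * x ^ 2) l (𝓝 (a + b * e + c * e ^ 2)) := by
    have : Continuous fun x : ℝ => a + b * x + c * x ^ 2 := by fun_prop
    exact (this.tendsto e).mono_left hl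
  have := tendsto_nhds_unique h2 (h.trans_tendsto h1)
  rwa [he, mul_one] at this

/-- The homogeneous problem has only the trivial solution. The solutions without boundary condition
are a quadratic polynomial divided by `√(1 - x²)`; the boundary condition makes the polynomial
`o(1 - x²)` at both endpoints, hence zero. -/
theorem ae_eq_zero_of_homogeneous {d : ℝ → ℝ} (hd : Integrable d)
    (hd0 : ∀ x ∉ Ioo (-1 : ℝ) 1, d x = 0)
    (hlog : ∀ φ : 𝓓(symmInterval, ℝ), ∫ x, d x * ∫ y, Real.log (x - y) *
      (∂_{(1 : ℝ)} (∂_{(1 : ℝ)} (∂_{(1 : ℝ)} φ)) : 𝓓(symmInterval, ℝ)) y = 0)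
    (hl : d =o[𝓝[>] (-1)] fun x => √(1 - x ^ 2)) (hr : d =o[𝓝[<] 1] fun x => √(1 - x ^ 2)) :
    d =ᵐ[volume] 0 := by
  obtain ⟨a, b, c, h⟩ := exists_ae_eq_quadratic_mul_arcsine hd hd0 hlog
  rw [← nhdsWithin_Ioo_eq_nhdsGT (show (-1 : ℝ) < 1 by norm_num)] at hl
  rw [← nhdsWithin_Ioo_eq_nhdsLT (show (-1 : ℝ) < 1 by norm_num)] at hr
  obtain ⟨l₁, _, hl₁, _, ho₁⟩ := exists_filter_isLittleO_of_ae (by norm_num) h hl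
  obtain ⟨l₂, _, hl₂, hm₂, ho₂⟩ := exists_filter_isLittleO_of_ae (by norm_num) h hr
  have h1 := quadratic_eq_zero_of_isLittleO (by norm_num) hl₁ ho₁
  have h2 := quadratic_eq_zero_of_isLittleO (by norm_num) hl₂ ho₂
  have hb : b = 0 := by linarith
  have ha : a = -c := by linarith
  subst hb ha
  have hc : c = 0 := by
    by_contra hc
    have e : (fun x : ℝ => -c + 0 * x + c * x ^ 2) = fun x => -c * (1 - x ^ 2) := by
      ext x; ring
    rw [e, isLittleO_const_mul_left_iff (neg_ne_zero.2 hc)] at ho₂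
    refine isLittleO_irrefl (Eventually.frequently ?_) ho₂
    filter_upwards [hm₂] with x hx
    nlinarith [hx.1, hx.2]
  subst hc
  filter_upwards [h] with x hx
  by_cases hxI : x ∈ Ioo (-1 : ℝ) 1
  · rw [hx hxI]; simp
  · exact hd0 x hxI

theorem IsGreenSolution.ae_eq {z : ℝ} {u v : ℝ → ℝ} (hu : IsGreenSolution z u)
    (hv : IsGreenSolution z v) : u =ᵐ[volume] v := by
  have h : u - v =ᵐ[volume] 0 := by
    refine ae_eq_zero_of_homogeneous (hu.integrable.sub hv.integrable)
      (fun x hx => by rw [Pi.sub_apply, hu.eq_zero x hx, hv.eq_zero x hx, sub_zero]) (fun φ => ?_)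
      (hu.isLittleO_left.sub hv.isLittleO_left) (hu.isLittleO_right.sub hv.isLittleO_right)
    have e₁ := (equation_iff hu.integrable z).1 hu.equation φ
    have e₂ := (equation_iff hv.integrable z).1 hv.equation φ
    simp only [Pi.sub_apply, sub_mul]
    rw [integral_sub, e₁, e₂, sub_self]
    · exact integrable_mul_integral_log hu.integrable hu.eq_zero (TestFunction.continuous _)
        fun _ hy => test_eq_zero hy
    · exact integrable_mul_integral_log hv.integrable hv.eq_zero (TestFunction.continuous _)
        fun _ hy => test_eq_zero hy
  filter_upwards [h] with x hx
  exact sub_eq_zero.1 hx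

end HydraulicFracture

end

theorem proposition3p2 (z : ℝ) (hz : z ∈ Set.Ioo (-1 : ℝ) 1) :
    Continuous (fun x : ℝ => HydraulicFracture.greenG x z) ∧
    HydraulicFracture.IsGreenSolution z (fun x : ℝ => HydraulicFracture.greenG x z) ∧
    (∀ u : ℝ → ℝ, HydraulicFracture.IsGreenSolution z u →
      u =ᵐ[MeasureTheory.volume] fun x : ℝ => HydraulicFracture.greenG x z) ∧
    (∀ u : ℝ → ℝ, HydraulicFracture.IsGreenSolution z u →
      ContinuousOn u (Set.Ioo (-1 : ℝ) 1) →
        u = fun x : ℝ => HydraulicFracture.greenG x z) := by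
  have hcont := HydraulicFracture.continuous_greenG hz
  have hsol := HydraulicFracture.isGreenSolution_greenG hz
  refine ⟨hcont, hsol, fun u hu => hu.ae_eq hsol, fun u hu huc => funext fun x => ?_⟩
  by_cases hx : x ∈ Ioo (-1 : ℝ) 1
  · exact Measure.eqOn_open_of_ae_eq (ae_restrict_of_ae (hu.ae_eq hsol)) isOpen_Ioo huc
      hcont.continuousOn hx
  · rw [hu.eq_zero x hx, hsol.eq_zero x hx]
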